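/- Let $E\ge 2$ and let $S_E$ be a star graph with $E$ arms: $E$ paths, each with at least one edge, glued together at a common end vertex (the centre). Let $n\ge 0$ and suppose that $S_E$ is sufficiently subdivided for $n$ particles, i.e. each path between distinct vertices of valence different from $2$ has at least $n-1$ edges (for $E\ge 3$ and $n\ge 2$: each arm has at least $n-1$ edges) and each closed path has at least $n+1$ edges (vacuous here, as $S_E$ is a tree). For a finite simple graph $\Gamma$ let $\mathcal D^n(\Gamma)=(\Gamma^{\times n}-\tilde\Delta)/S_n$ be the $n$-particle combinatorial configuration space, where $\tilde\Delta$ consists of all cells of $\Gamma^{\times n}$ whose closure meets the set of $n$-tuples with two equal entries. It is a cell complex whose $k$-cells are the unordered collections of $n$ cells of $\Gamma$ (vertices and edges) with pairwise disjoint closures, exactly $k$ of which are edges. Then the integral (cellular) homology group $H_1(\mathcal D^n(S_E))$ is finitely generated and its rank is $$\beta_n^E=\binom{n+E-2}{E-1}(E-2)-\binom{n+E-2}{E-2}+1 .$$ In particular, for $E\ge 3$ the rank depends on the number of particles: if $1\le n<m$, then the rank of $H_1(\mathcal D^n(S_E))$ is strictly less than the rank of $H_1(\mathcal D^m(S_E))$,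 where for each of the two particle numbers $S_E$ is any star graph with $E$ arms that is sufficiently subdivided for that number. -/

import Mathlib

/-! ### Sufficiently subdivided graphs -/

/-- A graph is sufficiently subdivided for `n` particles if every path between distinct vertices
of valence different from two has at least `n - 1` edges, and every closed path (cycle) has at
least `n + 1` edges. -/
def SufficientlySubdivided {V : Type*} (G : SimpleGraph V) (n : ℕ) : Prop :=
  (∀ v w : V, v ≠ w → (G.neighborSet v).ncard ≠ 2 → (G.neighborSet w).ncard ≠ 2 →
    ∀ p : G.Walk v w, p.IsPath → n ≤ p.length + 1) ∧
  (∀ (v : V) (p : G.Walk v v), p.IsCycle → n + 1 ≤ p.length)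

/-! ### The combinatorial configuration space `𝒟ⁿ(Γ)` of `n` indistinguishable particles

The cells of `𝒟ⁿ(Γ) = (Γⁿ - Δ̃) / Sₙ` are the unordered collections of `n` cells of `Γ` (vertices
and edges) whose closures are pairwise disjoint; the dimension of such a cell is the number of
edges in it.  It is a cube complex, and its homology is computed by the cellular chain complex
below.  A linear order on the vertices is used only to choose orientations: an edge is oriented
from its smaller to its larger endpoint, and the edges in a cell are ordered by their initial
vertices. -/

/-- The `k`-dimensional cells of `𝒟ⁿ(Γ)`: `verts` are the particles sitting at vertices, `edges`
the particles sitting on (oriented) edges. -/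
@[ext]
structure ConfCell {V : Type*} [LinearOrder V] (G : SimpleGraph V) (n k : ℕ) where
  verts : Finset V
  edges : Finset (V × V)
  lt_of_mem : ∀ e ∈ edges, e.1 < e.2
  adj_of_mem : ∀ e ∈ edges, G.Adj e.1 e.2
  disjoint_edges : ∀ e ∈ edges, ∀ f ∈ edges, e ≠ f →
    e.1 ≠ f.1 ∧ e.1 ≠ f.2 ∧ e.2 ≠ f.1 ∧ e.2 ≠ f.2
  disjoint_verts : ∀ e ∈ edges, e.1 ∉ verts ∧ e.2 ∉ verts
  card_edges : edges.card = k
  card_verts : verts.card + k = n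

namespace ConfCell

variable {V : Type*} [LinearOrder V] {G : SimpleGraph V} {n k : ℕ}

/-- The face of a cell obtained by moving the particle on the edge `e` to the endpoint `v`. -/
def face (c : ConfCell G n (k + 1)) (e : V × V) (he : e ∈ c.edges) (v : V)
    (hv : v = e.1 ∨ v = e.2) : ConfCell G n k where
  verts := insert v c.verts
  edges := c.edges.erase e
  lt_of_mem f hf := c.lt_of_mem f (Finset.mem_of_mem_erase hf)
  adj_of_mem f hf := c.adj_of_mem f (Finset.mem_of_mem_erase hf)
  disjoint_edges f hf g hg :=
    c.disjoint_edges f (Finset.mem_of_mem_erase hf) g (Finset.mem_of_mem_erase hg)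
  disjoint_verts f hf := by
    have h1 := c.disjoint_verts f (Finset.mem_of_mem_erase hf)
    have h2 := c.disjoint_edges f (Finset.mem_of_mem_erase hf) e he (Finset.ne_of_mem_erase hf)
    rcases hv with rfl | rfl <;> simp [h1, h2]
  card_edges := by rw [Finset.card_erase_of_mem he, c.card_edges]; rfl
  card_verts := by
    have h1 := c.disjoint_verts e he
    have h2 := c.card_verts
    have h3 : v ∉ c.verts := by rcases hv with rfl | rfl <;> simp [h1]
    rw [Finset.card_insert_of_notMem h3]
    omega

/-- The sign of the edge `e` in the boundary of `c`: `(-1)` to the number of edges of `c` that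
precede `e`. -/
def edgeSign (c : ConfCell G n k) (e : V × V) : ℤ :=
  (-1) ^ (c.edges.filter fun f => f.1 < e.1).card

/-- The difference "head minus tail" of the two opposite faces of `c` in the direction of the
edge `e`. -/
noncomputable def faceDiff (c : ConfCell G n (k + 1)) (e : V × V) (he : e ∈ c.edges) :
    ConfCell G n k →₀ ℤ :=
  Finsupp.single (c.face e he e.2 (Or.inr rfl)) 1 - Finsupp.single (c.face e he e.1 (Or.inl rfl)) 1

end ConfCell

/-- The cellular boundary map `∂ : C_{k+1}(𝒟ⁿ(Γ)) → C_k(𝒟ⁿ(Γ))`. -/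
noncomputable def confBoundary {V : Type*} [LinearOrder V] (G : SimpleGraph V) (n k : ℕ) :
    (ConfCell G n (k + 1) →₀ ℤ) →ₗ[ℤ] (ConfCell G n k →₀ ℤ) :=
  Finsupp.linearCombination ℤ fun c =>
    ∑ e : {e // e ∈ c.edges}, c.edgeSign e.1 • c.faceDiff e.1 e.2

theorem ConfCell.edgeSign_face {V : Type*} [LinearOrder V] {G : SimpleGraph V} {n k : ℕ}
    (c : ConfCell G n (k + 1)) (e : V × V) (he : e ∈ c.edges) (v : V) (hv : v = e.1 ∨ v = e.2)
    (f : V × V) :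
    (c.face e he v hv).edgeSign f = (if e.1 < f.1 then -1 else 1) * c.edgeSign f := by
  unfold ConfCell.edgeSign ConfCell.face
  simp only [Finset.filter_erase]
  split_ifs with h
  · have hm : e ∈ c.edges.filter fun g => g.1 < f.1 := by simp [he, h]
    rw [← Finset.card_erase_add_one hm, pow_succ]
    ring
  · have hm : e ∉ c.edges.filter fun g => g.1 < f.1 := by simp [h]
    rw [Finset.erase_eq_of_notMem hm, one_mul]

theorem ConfCell.face_comm {V : Type*} [LinearOrder V] {G : SimpleGraph V} {n k : ℕ}
    (c : ConfCell G n (k + 1 + 1)) (e f : V × V) (he : e ∈ c.edges) (hf : f ∈ c.edges)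
    (hef : e ≠ f) (v w : V) (hv : v = e.1 ∨ v = e.2) (hw : w = f.1 ∨ w = f.2) :
    (c.face e he v hv).face f (Finset.mem_erase.2 ⟨hef.symm, hf⟩) w hw =
      (c.face f hf w hw).face e (Finset.mem_erase.2 ⟨hef, he⟩) v hv := by
  refine ConfCell.ext ?_ ?_
  · exact Finset.insert_comm _ _ _
  · exact Finset.erase_right_comm

theorem confBoundary_single {V : Type*} [LinearOrder V] {G : SimpleGraph V} {n k : ℕ}
    (c : ConfCell G n (k + 1)) :
    confBoundary G n k (Finsupp.single c 1) =
      ∑ e ∈ c.edges, if he : e ∈ c.edges then c.edgeSign e • c.faceDiff e he else 0 := by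
  rw [← Finset.sum_attach]
  simp only [confBoundary, Finsupp.linearCombination_single, one_smul]
  exact Finset.sum_congr rfl fun e _ => by rw [dif_pos e.2]

theorem confBoundary_comp {V : Type*} [LinearOrder V] (G : SimpleGraph V) (n k : ℕ) :
    confBoundary G n k ∘ₗ confBoundary G n (k + 1) = 0 := by
  classical
  refine Finsupp.lhom_ext' fun c => LinearMap.ext_ring ?_
  -- the contribution of an ordered pair of edges, without its sign
  let X : V × V → V × V → (ConfCell G n k →₀ ℤ) := fun e f =>
    if h : e ∈ c.edges ∧ f ∈ c.edges ∧ e ≠ f then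
      ((c.face e h.1 e.2 (Or.inr rfl)).faceDiff f (Finset.mem_erase.2 ⟨h.2.2.symm, h.2.1⟩) -
        (c.face e h.1 e.1 (Or.inl rfl)).faceDiff f (Finset.mem_erase.2 ⟨h.2.2.symm, h.2.1⟩))
    else 0
  have hX : ∀ e f, X e f = X f e := by
    intro e f
    by_cases h : e ∈ c.edges ∧ f ∈ c.edges ∧ e ≠ f
    · have h' : f ∈ c.edges ∧ e ∈ c.edges ∧ f ≠ e := ⟨h.2.1, h.1, h.2.2.symm⟩
      simp only [X, dif_pos h, dif_pos h', ConfCell.faceDiff]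
      rw [c.face_comm e f h.1 h.2.1 h.2.2, c.face_comm e f h.1 h.2.1 h.2.2,
        c.face_comm e f h.1 h.2.1 h.2.2, c.face_comm e f h.1 h.2.1 h.2.2]
      abel
    · have h' : ¬ (f ∈ c.edges ∧ e ∈ c.edges ∧ f ≠ e) := fun h' =>
        h ⟨h'.2.1, h'.1, h'.2.2.symm⟩
      simp only [X, dif_neg h, dif_neg h']
  let Y : V × V → V × V → (ConfCell G n k →₀ ℤ) := fun e f =>
    (c.edgeSign e * ((if e.1 < f.1 then -1 else 1) * c.edgeSign f)) • X e f
  have hY : ∀ e ∈ c.edges, ∀ f ∈ c.edges, Y e f = - Y f e := by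
    intro e he f hf
    by_cases hef : e = f
    · subst hef
      simp [Y, X]
    · have hne : e.1 ≠ f.1 := (c.disjoint_edges e he f hf hef).1
      simp only [Y, hX e f, ← neg_smul]
      congr 1
      rcases lt_or_gt_of_ne hne with h | h
      · rw [if_pos h, if_neg h.le.not_gt]; ring
      · rw [if_pos h, if_neg h.le.not_gt]; ring
  have hmain : confBoundary G n k (confBoundary G n (k + 1) (Finsupp.single c 1)) =
      ∑ e ∈ c.edges, ∑ f ∈ c.edges, Y e f := by
    rw [confBoundary_single, map_sum]
    refine Finset.sum_congr rfl fun e he => ?_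
    rw [dif_pos he, map_smul, ConfCell.faceDiff, map_sub, confBoundary_single,
      confBoundary_single]
    change _ • ((∑ f ∈ c.edges.erase e, _) - (∑ f ∈ c.edges.erase e, _)) = _
    rw [← Finset.sum_sub_distrib, Finset.smul_sum, ← Finset.sum_erase (s := c.edges) (a := e)]
    · refine Finset.sum_congr rfl fun f hf => ?_
      have hf1 := Finset.mem_of_mem_erase hf
      have hf2 := Finset.ne_of_mem_erase hf
      have h : e ∈ c.edges ∧ f ∈ c.edges ∧ e ≠ f := ⟨he, hf1, hf2.symm⟩
      have hfm : ∀ v hv, f ∈ (c.face e he v hv).edges := fun v hv => hf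
      rw [dif_pos (hfm _ _), dif_pos (hfm _ _)]
      simp only [Y, X, dif_pos h, ConfCell.edgeSign_face, mul_smul, smul_sub]
    · simp [Y, X]
  have hneg : ∑ e ∈ c.edges, ∑ f ∈ c.edges, Y e f = - ∑ e ∈ c.edges, ∑ f ∈ c.edges, Y e f := by
    conv_lhs => rw [Finset.sum_comm]
    simp only [← Finset.sum_neg_distrib]
    exact Finset.sum_congr rfl fun f hf => Finset.sum_congr rfl fun e he => hY e he f hf
  have hz : ∑ e ∈ c.edges, ∑ f ∈ c.edges, Y e f = 0 := by
    refine Finsupp.ext fun d => ?_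
    have := DFunLike.congr_fun hneg d
    rw [Finsupp.neg_apply] at this
    rw [Finsupp.zero_apply]
    omega
  simpa [hz] using hmain

/-- The first homology group `H₁(𝒟ⁿ(Γ)) = ker ∂₁ / im ∂₂` with integer coefficients. -/
abbrev ConfH1 {V : Type*} [LinearOrder V] (G : SimpleGraph V) (n : ℕ) : Type _ :=
  LinearMap.ker (confBoundary G n 0) ⧸
    LinearMap.range ((confBoundary G n 1).codRestrict (LinearMap.ker (confBoundary G n 0))
      fun x => LinearMap.congr_fun (confBoundary_comp G n 0) x)

/-! ### Star graphs -/

/-- The vertices of the star graph whose `i`-th arm has `L i` edges: the centre, and the vertices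
`arm i j` at distance `j + 1` from the centre along the `i`-th arm. -/
inductive StarVertex {E : ℕ} (L : Fin E → ℕ) : Type
  | center : StarVertex L
  | arm (i : Fin E) (j : Fin (L i)) : StarVertex L

/-- The key by which the vertices of a star graph are ordered: centre first, then arm by arm. -/
def StarVertex.key {E : ℕ} {L : Fin E → ℕ} : StarVertex L → ℕ ×ₗ ℕ
  | .center => toLex (0, 0)
  | .arm i j => toLex ((i : ℕ) + 1, (j : ℕ))

theorem StarVertex.key_injective {E : ℕ} {L : Fin E → ℕ} :
    Function.Injective (StarVertex.key : StarVertex L → ℕ ×ₗ ℕ) := by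
  rintro (_ | ⟨i, j⟩) (_ | ⟨i', j'⟩) h
  · rfl
  · simp [StarVertex.key] at h
  · simp [StarVertex.key] at h
  · simp only [StarVertex.key, EmbeddingLike.apply_eq_iff_eq, Prod.mk.injEq,
      Nat.add_right_cancel_iff] at h
    obtain ⟨h1, h2⟩ := h
    obtain rfl := Fin.ext h1
    obtain rfl := Fin.ext h2
    rfl

instance StarVertex.instLinearOrder {E : ℕ} (L : Fin E → ℕ) : LinearOrder (StarVertex L) :=
  LinearOrder.lift' StarVertex.key StarVertex.key_injective

/-- The subdivided star graph with `E` arms, the `i`-th arm being a path of `L i` edges that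
starts at the centre. -/
def subdividedStar {E : ℕ} (L : Fin E → ℕ) : SimpleGraph (StarVertex L) :=
  SimpleGraph.fromRel fun v w =>
    match v, w with
    | .center, .arm _ j => (j : ℕ) = 0
    | .arm i j, .arm i' j' => i = i' ∧ (j' : ℕ) = (j : ℕ) + 1
    | _, _ => False

/-! The star is a tree rooted at its centre, so every edge is the edge below a unique non-central
vertex. Rank counting gives rank H₁ + rank C₀ = rank (C₁ / im ∂₂) + rank (C₀ / im ∂₁)
(`finrank_homology_add_finrank`), and the last rank is 1 because particles can be carried along
walks from any configuration to any other (`finrank_quotient_range_confBoundary_zero`).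

The heart is an explicit basis of C₁ / im ∂₂, in the spirit of discrete Morse theory
(`finrank_quotient_range_confBoundary_one`). A configuration is packed if on each arm the particles
fill an initial segment. Each unpacked configuration contributes the 1-cell that moves its first
movable particle one step inward. Each packed configuration with empty centre, together with an
occupied neighbour `s` of the centre, contributes the 1-cell on the edge from the centre to `s`.
These span, because the boundary of a 2-cell allows a spectator particle to be pushed inward, by
induction on total height. They are independent, because they are triangular against functionals
vanishing on im ∂₂: the coefficient of an unpacked configuration in the boundary, and the number of
crossings of a given central edge with given arm occupancies.

The unpacked configurations are also 0-cells and cancel, leaving rank H₁ = #`PackedCentral` -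
#`PackedConf` + 1, as for a connected graph with these numbers of edges and vertices
(`finrank_confH1_add`). A packed configuration is a distribution of the particles over the arms plus
the state of the centre, and a central cell is a distribution with a chosen nonempty arm, so
binomial coefficients finish the count. Two arms are treated separately: the centre then has valence
two and only the sum of the arm lengths is bounded below. Monotonicity in the particle number is
Pascal's rule. -/

/-! ### Linear algebra: triangular families modulo a submodule, and rank counting for homology. -/

section LinearAlgebra

/-- In a vanishing combination take an index `b` of the support with `μ b` maximal: `ℓ b` then kills
every other term, so the coefficient at `b` is zero. Ties in `μ` are harmless. -/
theorem linearIndependent_mkQ_of_triangular {M B α : Type*} [AddCommGroup M] [LinearOrder α]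
    (N : Submodule ℤ M) (g : B → M) (ℓ : B → M →ₗ[ℤ] ℤ) (μ : B → α)
    (hN : ∀ b, ∀ y ∈ N, ℓ b y = 0) (h1 : ∀ b, ℓ b (g b) = 1)
    (h0 : ∀ b b', b ≠ b' → μ b' ≤ μ b → ℓ b (g b') = 0) :
    LinearIndependent ℤ fun b => N.mkQ (g b) := by
  rw [linearIndependent_iff]
  intro x hx
  by_contra hne
  obtain ⟨b, hb, hmax⟩ := x.support.exists_max_image μ (Finsupp.support_nonempty_iff.2 hne)
  have hmem : Finsupp.linearCombination ℤ g x ∈ N := by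
    rw [← Submodule.Quotient.mk_eq_zero, ← Submodule.mkQ_apply, ← hx,
      Finsupp.apply_linearCombination]
    rfl
  have h := hN b _ hmem
  rw [Finsupp.linearCombination_apply, Finsupp.sum, map_sum, Finset.sum_eq_single b] at h
  · rw [map_smul, h1, smul_eq_mul, mul_one] at h
    exact Finsupp.mem_support_iff.1 hb h
  · intro b' hb' hne'
    rw [map_smul, h0 b b' hne'.symm (hmax b' hb'), smul_zero]
  · exact fun h => absurd hb h

theorem finrank_quotient_of_triangular {M B α : Type*} [AddCommGroup M] [LinearOrder α]
    (N : Submodule ℤ M) (g : B → M) (ℓ : B → M →ₗ[ℤ] ℤ) (μ : B → α)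
    (hN : ∀ b, ∀ y ∈ N, ℓ b y = 0) (h1 : ∀ b, ℓ b (g b) = 1)
    (h0 : ∀ b b', b ≠ b' → μ b' ≤ μ b → ℓ b (g b') = 0)
    (hspan : Submodule.span ℤ (Set.range g) ⊔ N = ⊤) :
    Module.finrank ℤ (M ⧸ N) = Nat.card B := by
  have hli := linearIndependent_mkQ_of_triangular N g ℓ μ hN h1 h0
  refine Module.finrank_eq_nat_card_basis (Module.Basis.mk hli ?_)
  have : Set.range (fun b => N.mkQ (g b)) = N.mkQ '' Set.range g := by
    rw [← Set.range_comp]; rfl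
  rw [this, Submodule.span_image]
  have h := congrArg (Submodule.map N.mkQ) hspan
  rw [Submodule.map_sup, Submodule.map_top, Submodule.range_mkQ, Submodule.mkQ_map_self,
    sup_bot_eq] at h
  exact h.ge

/-- Rank-nullity, used repeatedly. Restricting the codomain of `d₂` to `ker d₁` does not change its
kernel, hence not the rank of its image. -/
theorem finrank_homology_add_finrank {M₀ M₁ M₂ : Type*} [AddCommGroup M₀] [AddCommGroup M₁]
    [AddCommGroup M₂] [Module.Finite ℤ M₀] [Module.Finite ℤ M₁] (d₁ : M₁ →ₗ[ℤ] M₀)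
    (d₂ : M₂ →ₗ[ℤ] M₁) (h : ∀ x, d₂ x ∈ LinearMap.ker d₁) :
    Module.finrank ℤ (LinearMap.ker d₁ ⧸ LinearMap.range (d₂.codRestrict (LinearMap.ker d₁) h)) +
        Module.finrank ℤ M₀ =
      Module.finrank ℤ (M₁ ⧸ LinearMap.range d₂) + Module.finrank ℤ (M₀ ⧸ LinearMap.range d₁) := by
  have e1 := Submodule.finrank_quotient_add_finrank
    (LinearMap.range (d₂.codRestrict (LinearMap.ker d₁) h))
  have e2 := Submodule.finrank_quotient_add_finrank (LinearMap.range d₂)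
  have e3 := Submodule.finrank_quotient_add_finrank (LinearMap.range d₁)
  have e4 := Submodule.finrank_quotient_add_finrank (LinearMap.ker d₁)
  have e5 := d₁.quotKerEquivRange.finrank_eq
  have e6 : Module.finrank ℤ (LinearMap.range (d₂.codRestrict (LinearMap.ker d₁) h)) =
      Module.finrank ℤ (LinearMap.range d₂) := by
    rw [← LinearEquiv.finrank_eq (LinearMap.quotKerEquivRange _),
      ← LinearEquiv.finrank_eq (LinearMap.quotKerEquivRange _)]
    exact (Submodule.quotEquivOfEq _ _ (LinearMap.ker_codRestrict _ _ _)).finrank_eq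
  omega

end LinearAlgebra

/-! ### The star graph as a rooted tree. -/

namespace StarVertex

variable {E : ℕ} {L : Fin E → ℕ}

/-- The neighbour of a vertex that is nearer to the centre. -/
def parent : StarVertex L → StarVertex L
  | center => center
  | arm _ ⟨0, _⟩ => center
  | arm i ⟨j + 1, h⟩ => arm i ⟨j, Nat.lt_of_succ_lt h⟩

/-- The distance from the centre. -/
def height : StarVertex L → ℕ
  | center => 0
  | arm _ j => j + 1

/-- The arm that contains a vertex. -/
def armIdx : StarVertex L → Option (Fin E)
  | center => none
  | arm i _ => some i

theorem lt_iff {v w : StarVertex L} : v < w ↔ v.key < w.key := Iff.rfl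

theorem le_iff {v w : StarVertex L} : v ≤ w ↔ v.key ≤ w.key := Iff.rfl

theorem parent_lt {v : StarVertex L} (hv : v ≠ center) : v.parent < v := by
  rw [lt_iff]
  rcases v with _ | ⟨i, ⟨_ | j, hj⟩⟩
  · exact absurd rfl hv
  · simp [parent, key, Prod.Lex.toLex_lt_toLex]
  · simp [parent, key, Prod.Lex.toLex_lt_toLex]

/-- Since the centre is its own parent by convention, `v.parent ≠ center` alone singles out the
vertices at distance at least two from the centre. -/
theorem ne_center_of_parent {v : StarVertex L} (hv : v.parent ≠ center) : v ≠ center := by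
  rintro rfl
  exact hv rfl

/-- Arms are listed consecutively, so a parent other than the centre is the immediate predecessor in
the vertex order. -/
theorem le_parent_of_lt {v w : StarVertex L} (hv : v.parent ≠ center) (h : w < v) :
    w ≤ v.parent := by
  rw [lt_iff] at h
  rw [le_iff]
  rcases v with _ | ⟨i, ⟨_ | j, hj⟩⟩
  · exact absurd rfl hv
  · exact absurd rfl hv
  · rcases w with _ | ⟨i', ⟨j', hj'⟩⟩
    · simp [parent, key, Prod.Lex.toLex_le_toLex]
    · simp only [parent, key, Prod.Lex.toLex_lt_toLex, Prod.Lex.toLex_le_toLex] at h ⊢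
      exact h.imp id (And.imp_right Nat.le_of_lt_succ)

theorem height_parent {v : StarVertex L} (hv : v ≠ center) : v.parent.height < v.height := by
  rcases v with _ | ⟨i, ⟨_ | j, hj⟩⟩
  · exact absurd rfl hv
  · simp [parent, height]
  · simp [parent, height]

theorem armIdx_parent {v : StarVertex L} (hv : v.parent ≠ center) :
    v.parent.armIdx = v.armIdx := by
  rcases v with _ | ⟨i, ⟨_ | j, hj⟩⟩
  · exact absurd rfl hv
  · exact absurd rfl hv
  · rfl

instance : Finite (StarVertex L) :=
  Finite.of_surjective
    (fun x : Option (Σ i, Fin (L i)) => x.elim center fun y => arm y.1 y.2) (by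
      rintro (_ | ⟨i, j⟩)
      · exact ⟨none, rfl⟩
      · exact ⟨some ⟨i, j⟩, rfl⟩)

/-- This identifies oriented edges with non-central vertices, the tail being the parent; cells can
then be indexed by vertices. -/
theorem adj_of_lt_iff {v w : StarVertex L} (h : v < w) :
    (subdividedStar L).Adj v w ↔ w ≠ center ∧ v = w.parent := by
  have hne := h.ne
  rw [lt_iff] at h
  rcases v with _ | ⟨i, ⟨j, hj⟩⟩ <;> rcases w with _ | ⟨i', ⟨_ | j', hj'⟩⟩ <;>
    simp only [subdividedStar, SimpleGraph.fromRel_adj, parent, key, Prod.Lex.toLex_lt_toLex,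
      arm.injEq, ne_eq] at h hne ⊢
  · simp at hne
  · simp
  · simp
  · simp at h
  · simp only [reduceCtorEq, not_false_eq_true, and_false, iff_false, not_and, not_or]
    refine fun _ => ⟨trivial, ?_⟩
    rintro rfl
    simp at h
  · constructor
    · rintro ⟨-, ⟨rfl, h2⟩ | ⟨rfl, h2⟩⟩
      · have : j = j' := by omega
        subst this
        simp
      · exfalso
        simp at h
        omega
    · rintro ⟨-, rfl, h2⟩
      have h2 : j = j' := by simpa using h2
      subst h2
      simp

theorem adj_parent {v : StarVertex L} (hv : v ≠ center) :
    (subdividedStar L).Adj v.parent v :=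
  (adj_of_lt_iff (parent_lt hv)).2 ⟨hv, rfl⟩

theorem adj_iff {v w : StarVertex L} :
    (subdividedStar L).Adj v w ↔
      (w ≠ center ∧ v = w.parent) ∨ (v ≠ center ∧ w = v.parent) := by
  rcases lt_trichotomy v w with h | rfl | h
  · rw [adj_of_lt_iff h, or_iff_left]
    rintro ⟨h1, rfl⟩
    exact lt_asymm h (parent_lt h1)
  · simp only [SimpleGraph.irrefl, or_self, false_iff, not_and]
    exact fun h1 h2 => (parent_lt h1).ne h2.symm
  · rw [SimpleGraph.adj_comm, adj_of_lt_iff h, or_iff_right]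
    rintro ⟨h1, rfl⟩
    exact lt_asymm h (parent_lt h1)

/-- The walk from a vertex to the centre. -/
theorem exists_walk_center (v : StarVertex L) :
    ∃ p : (subdividedStar L).Walk v center, p.length = v.height := by
  rcases v with _ | ⟨i, ⟨j, hj⟩⟩
  · exact ⟨.nil, rfl⟩
  · induction j with
    | zero => exact ⟨.cons (adj_parent (v := arm i ⟨0, hj⟩) (by simp)).symm .nil, rfl⟩
    | succ j ih =>
      obtain ⟨p, hp⟩ := ih (Nat.lt_of_succ_lt hj)
      refine ⟨.cons (adj_parent (v := arm i ⟨j + 1, hj⟩) (by simp)).symm p, ?_⟩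
      change p.length + 1 = _
      rw [hp]
      rfl

theorem connected_subdividedStar : (subdividedStar L).Connected := by
  have : Nonempty (StarVertex L) := ⟨center⟩
  refine ⟨fun v w => ?_⟩
  obtain ⟨p, -⟩ := exists_walk_center v
  obtain ⟨q, -⟩ := exists_walk_center w
  exact ⟨p.append q.reverse⟩

theorem ncard_neighborSet_center (hL : ∀ i, 1 ≤ L i) :
    ((subdividedStar L).neighborSet center).ncard = E := by
  have : (subdividedStar L).neighborSet center = Set.range fun i => arm i ⟨0, hL i⟩ := by
    ext v
    rw [SimpleGraph.mem_neighborSet, adj_iff]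
    rcases v with _ | ⟨i, ⟨_ | j, hj⟩⟩
    · simp
    · simp [parent]
    · simp [parent]
  rw [this, Set.ncard_range_of_injective]
  · simp
  · intro i i' h
    simpa [armIdx] using congrArg armIdx h

theorem ncard_neighborSet_leaf (i : Fin E) (hi : 0 < L i) :
    ((subdividedStar L).neighborSet (arm i ⟨L i - 1, by omega⟩)).ncard = 1 := by
  rw [Set.ncard_eq_one]
  refine ⟨(arm i ⟨L i - 1, by omega⟩ : StarVertex L).parent, ?_⟩
  ext v
  rw [SimpleGraph.mem_neighborSet, adj_iff]
  rcases v with _ | ⟨i', ⟨_ | j, hj⟩⟩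
  · simp [eq_comm]
  · simp [parent, eq_comm]
  · simp only [parent, ne_eq, reduceCtorEq, not_false_eq_true, arm.injEq, true_and,
      Set.mem_singleton_iff, or_iff_right_iff_imp, and_imp]
    rintro rfl h
    have : L i - 1 = j := by simpa using h
    omega

end StarVertex

/-! ### Arm lengths forced by sufficient subdivision. -/

-- The path from the leaf of the arm to the centre has at most `L i` edges; three arms make the
-- valence of the centre differ from two, so the path condition applies.
open StarVertex in
theorem SufficientlySubdivided.le_length_add_one {E : ℕ} {L : Fin E → ℕ} {n : ℕ}
    (h : SufficientlySubdivided (subdividedStar L) n) (hE : 3 ≤ E) (hL : ∀ i, 1 ≤ L i)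
    (i : Fin E) : n ≤ L i + 1 := by
  classical
  have hi := hL i
  obtain ⟨p, hp⟩ := exists_walk_center (arm i ⟨L i - 1, by omega⟩ : StarVertex L)
  have := h.1 _ _ (by simp) (by rw [ncard_neighborSet_leaf i hi]; omega)
    (by rw [ncard_neighborSet_center hL]; omega) p.bypass p.bypass_isPath
  have := p.length_bypass_le_length
  simp only [height] at hp
  omega

-- Here the path runs from leaf to leaf, which also covers two arms, where the centre has valence
-- two.
open StarVertex in
theorem SufficientlySubdivided.le_length_add_length {E : ℕ} {L : Fin E → ℕ} {n : ℕ}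
    (h : SufficientlySubdivided (subdividedStar L) n) (hL : ∀ i, 1 ≤ L i)
    {i j : Fin E} (hij : i ≠ j) : n ≤ L i + L j + 1 := by
  classical
  have hi := hL i
  have hj := hL j
  obtain ⟨p, hp⟩ := exists_walk_center (arm i ⟨L i - 1, by omega⟩ : StarVertex L)
  obtain ⟨q, hq⟩ := exists_walk_center (arm j ⟨L j - 1, by omega⟩ : StarVertex L)
  have h1 := h.1 _ _ (by simp [hij]) (by rw [ncard_neighborSet_leaf i hi]; omega)
    (by rw [ncard_neighborSet_leaf j hj]; omega) (p.append q.reverse).bypass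
    (p.append q.reverse).bypass_isPath
  have h2 := (p.append q.reverse).length_bypass_le_length
  rw [SimpleGraph.Walk.length_append, SimpleGraph.Walk.length_reverse] at h2
  simp only [height] at hp hq
  omega

/-! ### Cells of dimension at most two and their boundaries. -/

namespace StarVertex

variable {E : ℕ} {L : Fin E → ℕ} {n : ℕ}

/-- The edge below `v` and the vertices in `T` have disjoint closures, and form a 1-cell. -/
structure IsEdgeCell (n : ℕ) (v : StarVertex L) (T : Finset (StarVertex L)) : Prop where
  ne_center : v ≠ center
  notMem : v ∉ T
  parent_notMem : v.parent ∉ T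
  card_eq : T.card + 1 = n

/-- The edges below `v` and `w` and the vertices in `T` have disjoint closures, and form a
2-cell. -/
structure IsPairCell (n : ℕ) (v w : StarVertex L) (T : Finset (StarVertex L)) : Prop where
  left_ne : v ≠ center
  right_ne : w ≠ center
  ne : v ≠ w
  parent_ne : v.parent ≠ w
  ne_parent : v ≠ w.parent
  parent_ne_parent : v.parent ≠ w.parent
  left_notMem : v ∉ T
  left_parent_notMem : v.parent ∉ T
  right_notMem : w ∉ T
  right_parent_notMem : w.parent ∉ T
  card_eq : T.card + 2 = n

theorem IsPairCell.symm {v w : StarVertex L} {T : Finset (StarVertex L)}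
    (h : IsPairCell n v w T) : IsPairCell n w v T where
  left_ne := h.right_ne
  right_ne := h.left_ne
  ne := h.ne.symm
  parent_ne := h.ne_parent.symm
  ne_parent := h.parent_ne.symm
  parent_ne_parent := h.parent_ne_parent.symm
  left_notMem := h.right_notMem
  left_parent_notMem := h.right_parent_notMem
  right_notMem := h.left_notMem
  right_parent_notMem := h.left_parent_notMem
  card_eq := h.card_eq

theorem IsPairCell.insert_right {v w : StarVertex L} {T : Finset (StarVertex L)}
    (h : IsPairCell n v w T) : IsEdgeCell n v (insert w T) where
  ne_center := h.left_ne
  notMem := by simp [h.ne, h.left_notMem]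
  parent_notMem := by simp [h.parent_ne, h.left_parent_notMem]
  card_eq := by rw [Finset.card_insert_of_notMem h.right_notMem, ← h.card_eq]

theorem IsPairCell.insert_right_parent {v w : StarVertex L} {T : Finset (StarVertex L)}
    (h : IsPairCell n v w T) : IsEdgeCell n v (insert w.parent T) where
  ne_center := h.left_ne
  notMem := by simp [h.ne_parent, h.left_notMem]
  parent_notMem := by simp [h.parent_ne_parent, h.left_parent_notMem]
  card_eq := by rw [Finset.card_insert_of_notMem h.right_parent_notMem, ← h.card_eq]

/-- The 0-cell of `n` particles at the vertices in `S`. -/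
def vertCell (S : Finset (StarVertex L)) (h : S.card = n) :
    ConfCell (subdividedStar L) n 0 where
  verts := S
  edges := ∅
  lt_of_mem := by simp
  adj_of_mem := by simp
  disjoint_edges := by simp
  disjoint_verts := by simp
  card_edges := rfl
  card_verts := h

/-- The 1-cell of a particle on the edge below `v` and `n - 1` particles at the vertices in `T`. -/
def edgeCell (v : StarVertex L) (T : Finset (StarVertex L)) (h : IsEdgeCell n v T) :
    ConfCell (subdividedStar L) n 1 where
  verts := T
  edges := {(v.parent, v)}
  lt_of_mem := by simpa using parent_lt h.ne_center
  adj_of_mem := by simpa using adj_parent h.ne_center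
  disjoint_edges e he f hf hef := by
    rw [Finset.mem_singleton] at he hf
    exact absurd (he.trans hf.symm) hef
  disjoint_verts e he := by
    rw [Finset.mem_singleton] at he
    subst he
    exact ⟨h.parent_notMem, h.notMem⟩
  card_edges := rfl
  card_verts := h.card_eq

/-- The 2-cell of particles on the edges below `v` and `w` and `n - 2` particles at the vertices
in `T`. -/
def pairCell (v w : StarVertex L) (T : Finset (StarVertex L)) (h : IsPairCell n v w T) :
    ConfCell (subdividedStar L) n 2 where
  verts := T
  edges := {(v.parent, v), (w.parent, w)}
  lt_of_mem := by simpa using ⟨parent_lt h.left_ne, parent_lt h.right_ne⟩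
  adj_of_mem := by simpa using ⟨adj_parent h.left_ne, adj_parent h.right_ne⟩
  disjoint_edges e he f hf hef := by
    rw [Finset.mem_insert, Finset.mem_singleton] at he hf
    rcases he with rfl | rfl <;> rcases hf with rfl | rfl
    · exact absurd rfl hef
    · exact ⟨h.parent_ne_parent, h.parent_ne, h.ne_parent, h.ne⟩
    · exact ⟨h.parent_ne_parent.symm, h.ne_parent.symm, h.parent_ne.symm, h.ne.symm⟩
    · exact absurd rfl hef
  disjoint_verts e he := by
    rw [Finset.mem_insert, Finset.mem_singleton] at he
    rcases he with rfl | rfl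
    · exact ⟨h.left_parent_notMem, h.left_notMem⟩
    · exact ⟨h.right_parent_notMem, h.right_notMem⟩
  card_edges := Finset.card_pair fun h' => h.ne (congrArg Prod.snd h')
  card_verts := h.card_eq

theorem eq_vertCell (c : ConfCell (subdividedStar L) n 0) : c = vertCell c.verts c.card_verts :=
  ConfCell.ext rfl (Finset.card_eq_zero.1 c.card_edges)

theorem eq_parent_of_mem {k : ℕ} (c : ConfCell (subdividedStar L) n k)
    {e : StarVertex L × StarVertex L} (he : e ∈ c.edges) :
    e.2 ≠ center ∧ e.1 = e.2.parent :=
  (adj_of_lt_iff (c.lt_of_mem e he)).1 (c.adj_of_mem e he)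

theorem exists_eq_edgeCell (c : ConfCell (subdividedStar L) n 1) :
    ∃ v T, ∃ h : IsEdgeCell n v T, c = edgeCell v T h := by
  obtain ⟨⟨u, v⟩, hc⟩ := Finset.card_eq_one.1 c.card_edges
  have he : (u, v) ∈ c.edges := by simp [hc]
  obtain ⟨hv, hu⟩ := eq_parent_of_mem c he
  have h1 := c.disjoint_verts _ he
  simp only at hv hu h1
  subst hu
  exact ⟨v, c.verts, ⟨hv, h1.2, h1.1, c.card_verts⟩, ConfCell.ext rfl hc⟩

/-- The two edges are listed by increasing tail, the order that determines the signs in the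
boundary. -/
theorem exists_eq_pairCell (c : ConfCell (subdividedStar L) n 2) :
    ∃ v w T, ∃ h : IsPairCell n v w T, v.parent < w.parent ∧ c = pairCell v w T h := by
  obtain ⟨⟨u, v⟩, ⟨u', w⟩, hne, hc⟩ := Finset.card_eq_two.1 c.card_edges
  have he : (u, v) ∈ c.edges := by simp [hc]
  have hf : (u', w) ∈ c.edges := by simp [hc]
  obtain ⟨hv, hu⟩ := eq_parent_of_mem c he
  obtain ⟨hw, hu'⟩ := eq_parent_of_mem c hf
  have h1 := c.disjoint_verts _ he
  have h2 := c.disjoint_verts _ hf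
  have h3 := c.disjoint_edges _ he _ hf hne
  simp only at hv hu hw hu' h1 h2 h3
  subst hu hu'
  have h : IsPairCell n v w c.verts :=
    ⟨hv, hw, h3.2.2.2, h3.2.1, h3.2.2.1, h3.1, h1.2, h1.1, h2.2, h2.1, c.card_verts⟩
  rcases lt_or_gt_of_ne h3.1 with h4 | h4
  · exact ⟨v, w, c.verts, h, h4, ConfCell.ext rfl hc⟩
  · exact ⟨w, v, c.verts, h.symm, h4, ConfCell.ext rfl (hc.trans (Finset.pair_comm _ _))⟩

/-- The 0-chain of the 0-cell with vertex set `S`. -/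
noncomputable def vertChain (n : ℕ) (S : Finset (StarVertex L)) :
    ConfCell (subdividedStar L) n 0 →₀ ℤ :=
  open Classical in if h : S.card = n then Finsupp.single (vertCell S h) 1 else 0

/-- The 1-chain of the 1-cell with the edge below `v` and vertex set `T`. -/
noncomputable def edgeChain (n : ℕ) (v : StarVertex L) (T : Finset (StarVertex L)) :
    ConfCell (subdividedStar L) n 1 →₀ ℤ :=
  open Classical in if h : IsEdgeCell n v T then Finsupp.single (edgeCell v T h) 1 else 0

theorem vertChain_of_card {S : Finset (StarVertex L)} (h : S.card = n) :
    vertChain n S = Finsupp.single (vertCell S h) 1 := dif_pos h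

theorem edgeChain_of_isEdgeCell {v : StarVertex L} {T : Finset (StarVertex L)}
    (h : IsEdgeCell n v T) : edgeChain n v T = Finsupp.single (edgeCell v T h) 1 := dif_pos h

theorem confBoundary_edgeChain {v : StarVertex L} {T : Finset (StarVertex L)}
    (h : IsEdgeCell n v T) :
    confBoundary (subdividedStar L) n 0 (edgeChain n v T) =
      vertChain n (insert v T) - vertChain n (insert v.parent T) := by
  have h1 : (insert v T).card = n := by
    rw [Finset.card_insert_of_notMem h.notMem, h.card_eq]
  have h2 : (insert v.parent T).card = n := by
    rw [Finset.card_insert_of_notMem h.parent_notMem, h.card_eq]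
  rw [edgeChain_of_isEdgeCell h, vertChain_of_card h1, vertChain_of_card h2, confBoundary_single]
  have hmem : (v.parent, v) ∈ (edgeCell v T h).edges := Finset.mem_singleton_self _
  have hsign : (edgeCell v T h).edgeSign (v.parent, v) = 1 := by
    simp [ConfCell.edgeSign, edgeCell, Finset.filter_singleton]
  change ∑ e ∈ {(v.parent, v)}, _ = _
  rw [Finset.sum_singleton, dif_pos hmem, hsign, one_smul, ConfCell.faceDiff]
  congr 2
  · exact ConfCell.ext rfl (by simp [ConfCell.face, edgeCell, vertCell])
  · exact ConfCell.ext rfl (by simp [ConfCell.face, edgeCell, vertCell])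

/-- The boundary, up to sign, of the 2-cell with the edges below `v` and `w` and vertex set
`T`. -/
noncomputable def square (n : ℕ) (v w : StarVertex L) (T : Finset (StarVertex L)) :
    ConfCell (subdividedStar L) n 1 →₀ ℤ :=
  edgeChain n v (insert w T) - edgeChain n v (insert w.parent T) -
    (edgeChain n w (insert v T) - edgeChain n w (insert v.parent T))

theorem confBoundary_pairCell {v w : StarVertex L} {T : Finset (StarVertex L)}
    (h : IsPairCell n v w T) (hlt : v.parent < w.parent) :
    confBoundary (subdividedStar L) n 1 (Finsupp.single (pairCell v w T h) 1) =
      - square n v w T := by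
  have hne : (v.parent, v) ≠ (w.parent, w) := fun h' => h.ne (congrArg Prod.snd h')
  have hv : (v.parent, v) ∈ (pairCell v w T h).edges := Finset.mem_insert_self _ _
  have hw : (w.parent, w) ∈ (pairCell v w T h).edges := by simp [pairCell]
  have hsv : (pairCell v w T h).edgeSign (v.parent, v) = 1 := by
    simp [ConfCell.edgeSign, pairCell, Finset.filter_insert, Finset.filter_singleton, hlt.not_gt]
  have hsw : (pairCell v w T h).edgeSign (w.parent, w) = -1 := by
    simp [ConfCell.edgeSign, pairCell, Finset.filter_insert, Finset.filter_singleton, hlt]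
  rw [confBoundary_single]
  change ∑ e ∈ {(v.parent, v), (w.parent, w)}, _ = _
  rw [Finset.sum_pair hne, dif_pos hv, dif_pos hw, hsv, hsw, one_smul, neg_smul, one_smul,
    ConfCell.faceDiff, ConfCell.faceDiff, square, edgeChain_of_isEdgeCell h.insert_right,
    edgeChain_of_isEdgeCell h.insert_right_parent, edgeChain_of_isEdgeCell h.symm.insert_right,
    edgeChain_of_isEdgeCell h.symm.insert_right_parent]
  have e1 : ({(v.parent, v), (w.parent, w)} : Finset _).erase (v.parent, v) = {(w.parent, w)} :=
    Finset.erase_insert (by simpa using hne)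
  have e2 : ({(v.parent, v), (w.parent, w)} : Finset _).erase (w.parent, w) = {(v.parent, v)} := by
    rw [Finset.pair_comm, Finset.erase_insert (by simpa using hne.symm)]
  have f1 : (pairCell v w T h).face _ hv v (Or.inr rfl) = edgeCell w _ h.symm.insert_right :=
    ConfCell.ext rfl e1
  have f2 : (pairCell v w T h).face _ hv v.parent (Or.inl rfl) =
      edgeCell w _ h.symm.insert_right_parent := ConfCell.ext rfl e1
  have f3 : (pairCell v w T h).face _ hw w (Or.inr rfl) = edgeCell v _ h.insert_right :=
    ConfCell.ext rfl e2
  have f4 : (pairCell v w T h).face _ hw w.parent (Or.inl rfl) =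
      edgeCell v _ h.insert_right_parent := ConfCell.ext rfl e2
  rw [f1, f2, f3, f4]
  abel

theorem square_swap (v w : StarVertex L) (T : Finset (StarVertex L)) :
    square n w v T = - square n v w T := by
  simp only [square]
  abel

/-- Since `square` is antisymmetric in its two edges, the ordering of their tails no longer matters.
-/
theorem square_mem_range {v w : StarVertex L} {T : Finset (StarVertex L)}
    (h : IsPairCell n v w T) :
    square n v w T ∈ LinearMap.range (confBoundary (subdividedStar L) n 1) := by
  rcases lt_or_gt_of_ne h.parent_ne_parent with h1 | h1
  · rw [← neg_mem_iff, ← confBoundary_pairCell h h1]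
    exact LinearMap.mem_range_self _ _
  · rw [square_swap, ← confBoundary_pairCell h.symm h1]
    exact LinearMap.mem_range_self _ _

theorem range_confBoundary_le {N : Submodule ℤ (ConfCell (subdividedStar L) n 1 →₀ ℤ)}
    (hN : ∀ v w T, IsPairCell n v w T → square n v w T ∈ N) :
    LinearMap.range (confBoundary (subdividedStar L) n 1) ≤ N := by
  rintro _ ⟨x, rfl⟩
  induction x using Finsupp.induction_linear with
  | zero => simp
  | add x y hx hy => rw [map_add]; exact add_mem hx hy
  | single c a =>
    obtain ⟨v, w, T, h, hlt, rfl⟩ := exists_eq_pairCell c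
    rw [← mul_one a, ← smul_eq_mul, ← Finsupp.smul_single, map_smul, confBoundary_pairCell h hlt]
    exact Submodule.smul_mem _ _ (neg_mem (hN v w T h))

theorem eq_top_of_edgeChain_mem {N : Submodule ℤ (ConfCell (subdividedStar L) n 1 →₀ ℤ)}
    (hN : ∀ v T, IsEdgeCell n v T → edgeChain n v T ∈ N) : N = ⊤ := by
  rw [eq_top_iff]
  rintro x -
  induction x using Finsupp.induction_linear with
  | zero => simp
  | add x y hx hy => exact add_mem hx hy
  | single c a =>
    obtain ⟨v, T, h, rfl⟩ := exists_eq_edgeCell c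
    rw [← mul_one a, ← smul_eq_mul, ← Finsupp.smul_single, ← edgeChain_of_isEdgeCell h]
    exact Submodule.smul_mem _ _ (hN v T h)

theorem eq_top_of_vertChain_mem {N : Submodule ℤ (ConfCell (subdividedStar L) n 0 →₀ ℤ)}
    (hN : ∀ S : Finset (StarVertex L), S.card = n → vertChain n S ∈ N) : N = ⊤ := by
  rw [eq_top_iff]
  rintro x -
  induction x using Finsupp.induction_linear with
  | zero => simp
  | add x y hx hy => exact add_mem hx hy
  | single c a =>
    rw [eq_vertCell c, ← mul_one a, ← smul_eq_mul, ← Finsupp.smul_single,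
      ← vertChain_of_card c.card_verts]
    exact Submodule.smul_mem _ _ (hN _ c.card_verts)

instance {k : ℕ} : Finite (ConfCell (subdividedStar L) n k) := by
  refine Finite.of_injective (β := Finset (StarVertex L) × Finset (StarVertex L × StarVertex L))
    (fun c => (c.verts, c.edges)) fun c d h => ?_
  simp only [Prod.mk.injEq] at h
  exact ConfCell.ext h.1 h.2

/-! ### Connectivity -/

theorem vertChain_sub_mem_range_of_adj {v w : StarVertex L} (h : (subdividedStar L).Adj v w)
    {S : Finset (StarVertex L)} (hS : S.card = n) (hv : v ∈ S) (hw : w ∉ S) :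
    vertChain n S - vertChain n (insert w (S.erase v)) ∈
      LinearMap.range (confBoundary (subdividedStar L) n 0) := by
  have hcard : (S.erase v).card + 1 = n := by rw [Finset.card_erase_add_one hv, hS]
  rcases adj_iff.1 h with ⟨h1, rfl⟩ | ⟨h1, rfl⟩
  · rw [← neg_mem_iff, neg_sub]
    nth_rw 2 [← Finset.insert_erase hv]
    rw [← confBoundary_edgeChain
      ⟨h1, fun h => hw (Finset.mem_of_mem_erase h), Finset.notMem_erase _ _, hcard⟩]
    exact LinearMap.mem_range_self _ _
  · nth_rw 1 [← Finset.insert_erase hv]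
    rw [← confBoundary_edgeChain
      ⟨h1, Finset.notMem_erase _ _, fun h => hw (Finset.mem_of_mem_erase h), hcard⟩]
    exact LinearMap.mem_range_self _ _

theorem vertChain_sub_mem_range_of_walk {v w : StarVertex L} (p : (subdividedStar L).Walk v w)
    {S : Finset (StarVertex L)} (hS : S.card = n) (hv : v ∈ S) (hw : w ∉ S) :
    vertChain n S - vertChain n (insert w (S.erase v)) ∈
      LinearMap.range (confBoundary (subdividedStar L) n 0) := by
  induction p generalizing S with
  | nil => exact absurd hv hw
  | @cons v u w h p ih =>
    have hvw : v ≠ w := fun h => hw (h ▸ hv)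
    -- If the next vertex `u` is occupied, its particle goes on to `w` and the particle at `v` then
    -- takes its place. As particles are indistinguishable, the result is the same as moving `v` to
    -- `w`.
    by_cases hu : u ∈ S
    · have h1 := ih hS hu hw
      have hS' : (insert w (S.erase u)).card = n := by
        rw [Finset.card_insert_of_notMem fun h => hw (Finset.mem_of_mem_erase h),
          Finset.card_erase_add_one hu, hS]
      have huw : u ≠ w := fun h => hw (h ▸ hu)
      have h2 := vertChain_sub_mem_range_of_adj h hS'
        (Finset.mem_insert_of_mem (Finset.mem_erase.2 ⟨h.ne, hv⟩)) (by simp [huw])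
      have h3 : insert u ((insert w (S.erase u)).erase v) = insert w (S.erase v) := by
        ext x
        simp only [Finset.mem_insert, Finset.mem_erase]
        by_cases hxu : x = u
        · subst hxu; simp [hu, h.ne.symm]
        · by_cases hxw : x = w
          · subst hxw; simp [hvw.symm]
          · simp [hxu, hxw]
      rw [h3] at h2
      simpa using add_mem h1 h2
    · have h1 := vertChain_sub_mem_range_of_adj h hS hv hu
      by_cases huw : u = w
      · subst huw
        exact h1
      · have hS' : (insert u (S.erase v)).card = n := by
          rw [Finset.card_insert_of_notMem fun h => hu (Finset.mem_of_mem_erase h),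
            Finset.card_erase_add_one hv, hS]
        have h2 := ih hS' (Finset.mem_insert_self _ _)
          (by simp [Ne.symm huw, hw])
        rw [Finset.erase_insert fun h => hu (Finset.mem_of_mem_erase h)] at h2
        simpa using add_mem h1 h2

/-- Exchange a vertex of `S \ T` for one of `T \ S` along a connecting walk; each exchange shrinks
`S \ T` by one. -/
theorem vertChain_sub_mem_range {S T : Finset (StarVertex L)} (hS : S.card = n)
    (hT : T.card = n) :
    vertChain n S - vertChain n T ∈ LinearMap.range (confBoundary (subdividedStar L) n 0) := by
  induction hk : (S \ T).card generalizing S with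
  | zero =>
    rw [Finset.card_eq_zero, Finset.sdiff_eq_empty_iff_subset] at hk
    rw [Finset.eq_of_subset_of_card_le hk (by rw [hS, hT]), sub_self]
    exact zero_mem _
  | succ k ih =>
    obtain ⟨v, hv⟩ : (S \ T).Nonempty := by rw [← Finset.card_pos]; omega
    obtain ⟨w, hw⟩ : (T \ S).Nonempty := by
      rw [← Finset.card_pos, ← Finset.card_sdiff_comm (hS.trans hT.symm)]; omega
    have hv' := Finset.mem_sdiff.1 hv
    have hw' := Finset.mem_sdiff.1 hw
    obtain ⟨p⟩ := connected_subdividedStar.preconnected v w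
    have h1 := vertChain_sub_mem_range_of_walk p hS hv'.1 hw'.2
    have h2 := ih (S := insert w (S.erase v))
      (by rw [Finset.card_insert_of_notMem fun h => hw'.2 (Finset.mem_of_mem_erase h),
            Finset.card_erase_add_one hv'.1, hS])
      (by
        rw [Finset.insert_sdiff_of_mem _ hw'.1, Finset.erase_sdiff_comm,
          Finset.card_erase_of_mem hv, hk, Nat.add_sub_cancel])
    simpa using add_mem h1 h2

/-- The augmentation kills boundaries and detects any single configuration; connectivity makes that
configuration span the quotient. -/
theorem finrank_quotient_range_confBoundary_zero
    (hn : ∃ S : Finset (StarVertex L), S.card = n) :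
    Module.finrank ℤ ((ConfCell (subdividedStar L) n 0 →₀ ℤ) ⧸
      LinearMap.range (confBoundary (subdividedStar L) n 0)) = 1 := by
  obtain ⟨S₀, hS₀⟩ := hn
  let aug : (ConfCell (subdividedStar L) n 0 →₀ ℤ) →ₗ[ℤ] ℤ :=
    Finsupp.linearCombination ℤ fun _ => 1
  have haug : ∀ S : Finset (StarVertex L), S.card = n → aug (vertChain n S) = 1 := fun S hS => by
    simp [aug, vertChain_of_card hS]
  have hcomp : aug ∘ₗ confBoundary (subdividedStar L) n 0 = 0 := by
    rw [← LinearMap.ker_eq_top]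
    refine eq_top_of_edgeChain_mem fun v T h => ?_
    rw [LinearMap.mem_ker, LinearMap.comp_apply, confBoundary_edgeChain h, map_sub, haug, haug,
      sub_self]
    · rw [Finset.card_insert_of_notMem h.parent_notMem, h.card_eq]
    · rw [Finset.card_insert_of_notMem h.notMem, h.card_eq]
  rw [finrank_quotient_of_triangular (B := Unit) _ (fun _ => vertChain n S₀) (fun _ => aug)
    (fun _ => (0 : ℕ))]
  · simp
  · rintro - _ ⟨x, rfl⟩
    exact LinearMap.congr_fun hcomp x
  · exact fun _ => haug S₀ hS₀
  · exact fun b b' h => absurd rfl h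
  · refine eq_top_of_vertChain_mem fun S hS => ?_
    have h1 := vertChain_sub_mem_range (L := L) hS hS₀
    have h2 : vertChain n S₀ ∈ Submodule.span ℤ (Set.range fun _ : Unit => vertChain n S₀) :=
      Submodule.subset_span ⟨(), rfl⟩
    simpa using add_mem (Submodule.mem_sup_left h2) (Submodule.mem_sup_right h1)

end StarVertex

namespace StarVertex

variable {E : ℕ} {L : Fin E → ℕ} {n : ℕ}

/-! ### A basis of the 1-chains modulo boundaries -/

/-- The particles that can be moved towards the centre without reaching it. -/
def movable (U : Finset (StarVertex L)) : Finset (StarVertex L) :=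
  {v ∈ U | v.parent ≠ center ∧ v.parent ∉ U}

theorem mem_movable {U : Finset (StarVertex L)} {v : StarVertex L} :
    v ∈ movable U ↔ v ∈ U ∧ v.parent ≠ center ∧ v.parent ∉ U := by
  simp [movable]

/-- On every arm, the particles occupy an initial segment. -/
def Packed (U : Finset (StarVertex L)) : Prop :=
  ∀ v ∈ U, v.parent ≠ center → v.parent ∈ U

theorem movable_nonempty_iff {U : Finset (StarVertex L)} :
    (movable U).Nonempty ↔ ¬ Packed U := by
  simp only [Packed, Finset.Nonempty, mem_movable]
  push Not
  rfl

/-- The first particle that can be moved towards the centre without reaching it. -/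
noncomputable def firstMovable (U : Finset (StarVertex L)) : StarVertex L :=
  if h : (movable U).Nonempty then (movable U).min' h else center

theorem firstMovable_mem {U : Finset (StarVertex L)} (h : ¬ Packed U) :
    firstMovable U ∈ movable U := by
  rw [firstMovable, dif_pos (movable_nonempty_iff.2 h)]
  exact Finset.min'_mem _ _

theorem firstMovable_eq {U : Finset (StarVertex L)} {v : StarVertex L} (hv : v ∈ movable U)
    (hmin : ∀ w ∈ U, w < v → w.parent ≠ center → w.parent ∈ U) : firstMovable U = v := by
  rw [firstMovable, dif_pos ⟨v, hv⟩]
  refine le_antisymm (Finset.min'_le _ _ hv) (Finset.le_min' _ _ _ fun w hw => ?_)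
  by_contra! hlt
  obtain ⟨h1, h2, h3⟩ := mem_movable.1 hw
  exact h3 (hmin w h1 hlt h2)

/-- The number of particles on each arm. -/
def counts (U : Finset (StarVertex L)) (i : Fin E) : ℕ :=
  (U.filter fun v => v.armIdx = some i).card

theorem counts_insert {U : Finset (StarVertex L)} {v : StarVertex L} (hv : v ∉ U) (i : Fin E) :
    counts (insert v U) i = counts U i + if v.armIdx = some i then 1 else 0 := by
  rw [counts, Finset.filter_insert]
  split_ifs with h
  · rw [Finset.card_insert_of_notMem (by simp [hv]), counts]
  · rw [counts, add_zero]

theorem counts_insert_parent {U : Finset (StarVertex L)} {v : StarVertex L} (hv : v ∉ U)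
    (hp : v.parent ∉ U) (hc : v.parent ≠ center) :
    counts (insert v.parent U) = counts (insert v U) := by
  ext i
  rw [counts_insert hv, counts_insert hp, armIdx_parent hc]

theorem Packed.arm_mem {U : Finset (StarVertex L)} (hU : Packed U) {i : Fin E} {j j' : ℕ}
    {hj : j < L i} {hj' : j' < L i} (h : arm i ⟨j, hj⟩ ∈ U) (hle : j' ≤ j) :
    arm i ⟨j', hj'⟩ ∈ U := by
  induction j with
  | zero =>
    obtain rfl : j' = 0 := by omega
    exact h
  | succ j ih =>
    rcases hle.eq_or_lt with rfl | hlt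
    · exact h
    · exact ih (hU _ h (by simp [parent])) (by omega)

/-- Initial segments of an arm are nested, so packed configurations off the centre are compared by
their occupation numbers, and in particular determined by them. -/
theorem Packed.subset_of_counts_le {U U' : Finset (StarVertex L)} (hU : Packed U)
    (hU' : Packed U') (hc : center ∉ U) (h : ∀ i, counts U i ≤ counts U' i) : U ⊆ U' := by
  intro x hx
  rcases x with _ | ⟨i, ⟨j, hj⟩⟩
  · exact absurd hx hc
  by_contra hx'
  have hlt : counts U' i < counts U i := by
    refine Finset.card_lt_card ((Finset.ssubset_iff_of_subset ?_).2 ⟨arm i ⟨j, hj⟩, ?_⟩)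
    · intro y hy
      obtain ⟨hy1, hy2⟩ := Finset.mem_filter.1 hy
      refine Finset.mem_filter.2 ⟨?_, hy2⟩
      rcases y with _ | ⟨i', ⟨j', hj'⟩⟩
      · simp [armIdx] at hy2
      · obtain rfl : i' = i := by simpa [armIdx] using hy2
        rcases le_total j j' with hle | hle
        · exact absurd (hU'.arm_mem hy1 hle) hx'
        · exact hU.arm_mem hx hle
    · exact ⟨Finset.mem_filter.2 ⟨hx, rfl⟩, fun h' => hx' (Finset.mem_filter.1 h').1⟩
  exact absurd (h i) hlt.not_ge

theorem Packed.eq_of_counts_eq {U U' : Finset (StarVertex L)} (hU : Packed U)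
    (hU' : Packed U') (hc : center ∉ U) (hc' : center ∉ U') (h : counts U = counts U') :
    U = U' :=
  (hU.subset_of_counts_le hU' hc fun i => (congrFun h i).le).antisymm
    (hU'.subset_of_counts_le hU hc' fun i => (congrFun h i).ge)

/-- The coefficient of the 1-cells in which a particle moves between the centre and `s`, and in
which the numbers of particles on the arms are prescribed. -/
noncomputable def centralCoeff (n : ℕ) (s : StarVertex L) (b : Fin E → ℕ) :
    (ConfCell (subdividedStar L) n 1 →₀ ℤ) →ₗ[ℤ] ℤ :=
  Finsupp.linearCombination ℤ fun c =>
    if (center, s) ∈ c.edges ∧ counts (insert s c.verts) = b then 1 else 0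

theorem centralCoeff_edgeChain {s v : StarVertex L} {T : Finset (StarVertex L)} {b : Fin E → ℕ}
    (hs : s.parent = center) (h : IsEdgeCell n v T) :
    centralCoeff n s b (edgeChain n v T) = if v = s ∧ counts (insert s T) = b then 1 else 0 := by
  rw [edgeChain_of_isEdgeCell h, centralCoeff, Finsupp.linearCombination_single, one_smul]
  have h1 : (center, s) ∈ (edgeCell v T h).edges ↔ v = s := by
    simp only [edgeCell, Finset.mem_singleton, Prod.mk.injEq]
    exact ⟨fun h => h.2.symm, fun h => ⟨by rw [h, hs], h.symm⟩⟩
  simp only [h1]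
  rfl

/-- If one edge of a 2-cell is the central edge at `s`, the other avoids the centre, so moving its
particle preserves the number on every arm. Opposite faces therefore have equal coefficients. -/
theorem centralCoeff_square {s v w : StarVertex L} {T : Finset (StarVertex L)} {b : Fin E → ℕ}
    (hs : s.parent = center) (h : IsPairCell n v w T) :
    centralCoeff n s b (square n v w T) = 0 := by
  have key : ∀ {v w : StarVertex L}, IsPairCell n v w T →
      centralCoeff n s b (edgeChain n v (insert w T)) =
        centralCoeff n s b (edgeChain n v (insert w.parent T)) := by
    intro v w h
    rw [centralCoeff_edgeChain hs h.insert_right, centralCoeff_edgeChain hs h.insert_right_parent]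
    by_cases hv : v = s
    · subst hv
      rw [Finset.insert_comm v w, Finset.insert_comm v w.parent, counts_insert_parent]
      · simp [h.ne.symm, h.right_notMem]
      · simp [h.ne_parent.symm, h.right_parent_notMem]
      · rw [← hs]
        exact h.parent_ne_parent.symm
    · simp [hv]
  rw [square, map_sub, map_sub, map_sub, key h, key h.symm]
  simp

theorem centralCoeff_eq_zero_of_mem_range {s : StarVertex L} {b : Fin E → ℕ}
    (hs : s.parent = center) {y : ConfCell (subdividedStar L) n 1 →₀ ℤ}
    (hy : y ∈ LinearMap.range (confBoundary (subdividedStar L) n 1)) :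
    centralCoeff n s b y = 0 :=
  range_confBoundary_le (N := LinearMap.ker (centralCoeff n s b))
    (fun _ _ _ h => centralCoeff_square hs h) hy

/-- The configurations of `n` particles that are not packed. -/
def Unpacked (L : Fin E → ℕ) (n : ℕ) : Set (Finset (StarVertex L)) :=
  {U | U.card = n ∧ ¬ Packed U}

/-- The packed configurations of `n` particles away from the centre, together with an occupied
neighbour of the centre. -/
def PackedCentral (L : Fin E → ℕ) (n : ℕ) : Set (StarVertex L × Finset (StarVertex L)) :=
  {p | p.2.card = n ∧ Packed p.2 ∧ center ∉ p.2 ∧ p.1 ∈ p.2 ∧ p.1.parent = center}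

/-- The 1-cells that form a basis of the 1-chains modulo boundaries. -/
noncomputable def basisCell (L : Fin E → ℕ) (n : ℕ) : Unpacked L n ⊕ PackedCentral L n →
    StarVertex L × Finset (StarVertex L)
  | .inl U => (firstMovable U.1, U.1.erase (firstMovable U.1))
  | .inr p => (p.1.1, p.1.2.erase p.1.1)

/-- The chain of a basis cell. -/
noncomputable def basisChain (L : Fin E → ℕ) (n : ℕ) (b : Unpacked L n ⊕ PackedCentral L n) :
    ConfCell (subdividedStar L) n 1 →₀ ℤ :=
  edgeChain n (basisCell L n b).1 (basisCell L n b).2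

theorem isEdgeCell_basisCell (b : Unpacked L n ⊕ PackedCentral L n) :
    IsEdgeCell n (basisCell L n b).1 (basisCell L n b).2 := by
  rcases b with ⟨U, hU, hp⟩ | ⟨⟨s, U⟩, hU, hp, hc, hs, hs'⟩
  · obtain ⟨h1, h2, h3⟩ := mem_movable.1 (firstMovable_mem hp)
    exact ⟨ne_center_of_parent h2, Finset.notMem_erase _ _,
      fun h => h3 (Finset.mem_of_mem_erase h), by
        rw [basisCell, Finset.card_erase_add_one h1, hU]⟩
  · exact ⟨fun h => hc (h ▸ hs), Finset.notMem_erase _ _,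
      fun h => hc (hs' ▸ Finset.mem_of_mem_erase h), by
        rw [basisCell, Finset.card_erase_add_one hs]; exact hU⟩

theorem vertChain_apply {S U : Finset (StarVertex L)} (hS : S.card = n) (hU : U.card = n) :
    vertChain n S (vertCell U hU) = if S = U then 1 else 0 := by
  rw [vertChain_of_card hS]
  by_cases h : S = U
  · subst h
    simp
  · rw [if_neg h, Finsupp.single_eq_of_ne]
    exact fun h' => h (congrArg ConfCell.verts h').symm

/-- The functional that detects a basis cell. -/
noncomputable def basisCoeff (L : Fin E → ℕ) (n : ℕ) :
    Unpacked L n ⊕ PackedCentral L n → (ConfCell (subdividedStar L) n 1 →₀ ℤ) →ₗ[ℤ] ℤ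
  | .inl U => Finsupp.lapply (vertCell U.1 U.2.1) ∘ₗ confBoundary (subdividedStar L) n 0
  | .inr p => centralCoeff n p.1.1 (counts p.1.2)

theorem basisCoeff_inl (U : Unpacked L n) {v : StarVertex L} {T : Finset (StarVertex L)}
    (h : IsEdgeCell n v T) : basisCoeff L n (.inl U) (edgeChain n v T) =
      (if insert v T = U.1 then 1 else 0) - (if insert v.parent T = U.1 then 1 else 0) := by
  have h1 : (insert v T).card = n := by
    rw [Finset.card_insert_of_notMem h.notMem, h.card_eq]
  have h2 : (insert v.parent T).card = n := by
    rw [Finset.card_insert_of_notMem h.parent_notMem, h.card_eq]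
  simp only [basisCoeff, LinearMap.comp_apply, confBoundary_edgeChain h, map_sub,
    Finsupp.lapply_apply, vertChain_apply h1, vertChain_apply h2]

/-- The order in which the basis cells are detected. -/
def basisLevel (L : Fin E → ℕ) (n : ℕ) : Unpacked L n ⊕ PackedCentral L n → WithTop ℕ
  | .inl U => ((∑ v ∈ U.1, v.height : ℕ) : WithTop ℕ)
  | .inr _ => ⊤

theorem basisCoeff_eq_zero_of_mem_range (b : Unpacked L n ⊕ PackedCentral L n)
    {y : ConfCell (subdividedStar L) n 1 →₀ ℤ}
    (hy : y ∈ LinearMap.range (confBoundary (subdividedStar L) n 1)) : basisCoeff L n b y = 0 := by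
  rcases b with U | p
  · obtain ⟨x, rfl⟩ := hy
    have : confBoundary (subdividedStar L) n 0 (confBoundary (subdividedStar L) n 1 x) = 0 :=
      LinearMap.congr_fun (confBoundary_comp (subdividedStar L) n 0) x
    simp only [basisCoeff, LinearMap.comp_apply, this, map_zero]
  · exact centralCoeff_eq_zero_of_mem_range p.2.2.2.2.2 hy

theorem basisCoeff_basisChain_self (b : Unpacked L n ⊕ PackedCentral L n) :
    basisCoeff L n b (basisChain L n b) = 1 := by
  have hb := isEdgeCell_basisCell b
  rcases b with ⟨U, hU, hp⟩ | ⟨⟨s, U⟩, hU, hp, hc, hs, hs'⟩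
  · rw [basisChain, basisCoeff_inl _ hb]
    obtain ⟨h1, h2, h3⟩ := mem_movable.1 (firstMovable_mem hp)
    rw [if_pos, if_neg, sub_zero]
    · intro h
      change insert (firstMovable U).parent (U.erase (firstMovable U)) = U at h
      exact h3 (h.subset (Finset.mem_insert_self _ _))
    · exact Finset.insert_erase h1
  · rw [basisChain, basisCoeff, centralCoeff_edgeChain hs' hb, if_pos]
    exact ⟨rfl, congrArg counts (Finset.insert_erase hs)⟩

/-- The boundary of the basis cell of an unpacked `U'` is `U'` minus a configuration of smaller
total height, whence the order by height. Basis cells of unpacked configurations use no central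
edge, so the central functionals vanish on them, and the central indices can sit on top. Among
central cells, arm occupancies determine the packed configuration. -/
theorem basisCoeff_basisChain_of_ne {b b' : Unpacked L n ⊕ PackedCentral L n} (hne : b ≠ b')
    (hle : basisLevel L n b' ≤ basisLevel L n b) : basisCoeff L n b (basisChain L n b') = 0 := by
  have hb' := isEdgeCell_basisCell b'
  rcases b with ⟨U, hU, hp⟩ | ⟨⟨s, U⟩, hU, hp, hc, hs, hs'⟩ <;>
    rcases b' with ⟨U', hU', hp'⟩ | ⟨⟨s', U'⟩, hU2, hp', hc', ht, ht'⟩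
  · obtain ⟨h1, h2, h3⟩ := mem_movable.1 (firstMovable_mem hp')
    rw [basisChain, basisCoeff_inl _ hb', if_neg, if_neg, sub_zero]
    · intro h
      simp only [basisLevel, Nat.cast_le] at hle
      change insert (firstMovable U').parent (U'.erase (firstMovable U')) = U at h
      rw [← h, Finset.sum_insert fun h' => h3 (Finset.mem_of_mem_erase h'),
        ← Finset.add_sum_erase _ _ h1] at hle
      have := height_parent (ne_center_of_parent h2)
      omega
    · intro h
      have : U' = U := (Finset.insert_erase h1).symm.trans h
      subst this
      exact hne rfl
  · simp [basisLevel] at hle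
  · rw [basisChain, basisCoeff, centralCoeff_edgeChain hs' hb', if_neg]
    rintro ⟨h, -⟩
    exact (mem_movable.1 (firstMovable_mem hp')).2.1 (by rw [← hs', ← h]; rfl)
  · rw [basisChain, basisCoeff, centralCoeff_edgeChain hs' hb', if_neg]
    rintro ⟨h, h'⟩
    simp only [basisCell] at h h'
    subst h
    rw [Finset.insert_erase ht] at h'
    have := hp'.eq_of_counts_eq hp hc' hc h'
    subst this
    exact hne rfl

/-- If no particle before `v` can move, then `v` is the first movable particle of `insert v T` and
the cell is itself a basis cell. -/
theorem edgeChain_mem_of_forall_lt {v : StarVertex L} {T : Finset (StarVertex L)}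
    (h : IsEdgeCell n v T) (hv : v.parent ≠ center)
    (hT : ∀ w ∈ T, w < v → w.parent ≠ center → w.parent ∈ T) :
    edgeChain n v T ∈ Submodule.span ℤ (Set.range (basisChain L n)) := by
  have hmem : v ∈ movable (insert v T) := by
    rw [mem_movable]
    exact ⟨Finset.mem_insert_self _ _, hv, by
      simp [h.parent_notMem, (parent_lt h.ne_center).ne]⟩
  have hfirst : firstMovable (insert v T) = v := by
    refine firstMovable_eq hmem fun w hw hlt hwc => ?_
    exact Finset.mem_insert_of_mem (hT w ((Finset.mem_insert.1 hw).resolve_left hlt.ne) hlt hwc)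
  refine Submodule.subset_span ⟨.inl ⟨insert v T, ?_, movable_nonempty_iff.1 ⟨v, hmem⟩⟩, ?_⟩
  · rw [Finset.card_insert_of_notMem h.notMem, h.card_eq]
  · simp only [basisChain, basisCell, hfirst, Finset.erase_insert h.notMem]

theorem edgeChain_mem_of_isPairCell {v w : StarVertex L} {T : Finset (StarVertex L)}
    (h : IsPairCell n v w T)
    {N : Submodule ℤ (ConfCell (subdividedStar L) n 1 →₀ ℤ)}
    (h1 : edgeChain n v (insert w.parent T) ∈ N) (h2 : edgeChain n w (insert v T) ∈ N)
    (h3 : edgeChain n w (insert v.parent T) ∈ N) :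
    edgeChain n v (insert w T) ∈
      N ⊔ LinearMap.range (confBoundary (subdividedStar L) n 1) := by
  have h4 := Submodule.mem_sup_right (S := N) (square_mem_range h)
  have h5 := Submodule.mem_sup_left (T := LinearMap.range (confBoundary (subdividedStar L) n 1))
    (add_mem h1 (sub_mem h2 h3))
  have h6 : edgeChain n v (insert w T) = square n v w T + (edgeChain n v (insert w.parent T) +
      (edgeChain n w (insert v T) - edgeChain n w (insert v.parent T))) := by
    rw [square]
    abel
  rw [h6]
  exact add_mem h4 h5

/-- The pair cell in which the edge below `w` is used to move the particle at `w`. -/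
theorem IsEdgeCell.isPairCell {v w : StarVertex L} {T : Finset (StarVertex L)}
    (h : IsEdgeCell n v T) (hw : w ∈ T) (hwc : w.parent ≠ center) (hwT : w.parent ∉ T)
    (hwv : w.parent ≠ v) (hne : w.parent ≠ v.parent) : IsPairCell n v w (T.erase w) where
  left_ne := h.ne_center
  right_ne := ne_center_of_parent hwc
  ne h' := h.notMem (h' ▸ hw)
  parent_ne h' := h.parent_notMem (h' ▸ hw)
  ne_parent := hwv.symm
  parent_ne_parent := hne.symm
  left_notMem h' := h.notMem (Finset.mem_of_mem_erase h')
  left_parent_notMem h' := h.parent_notMem (Finset.mem_of_mem_erase h')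
  right_notMem := Finset.notMem_erase _ _
  right_parent_notMem h' := hwT (Finset.mem_of_mem_erase h')
  card_eq := by
    rw [← h.card_eq, ← Finset.card_erase_add_one hw]

theorem sum_height_insert_parent_lt {w : StarVertex L} {T : Finset (StarVertex L)} (hw : w ∈ T)
    (hwc : w.parent ≠ center) (hwT : w.parent ∉ T) :
    ∑ x ∈ insert w.parent (T.erase w), x.height < ∑ x ∈ T, x.height := by
  rw [Finset.sum_insert fun h' => hwT (Finset.mem_of_mem_erase h'), ← Finset.add_sum_erase _ _ hw]
  have := height_parent (ne_center_of_parent hwc)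
  omega

/-- Let `w` be the first movable particle of `T` before `v`. The square on `v` and `w` replaces the
cell by one with `w` pushed inward, which has smaller height, and by two cells moving `w`. The
latter are basis cells: the extra particle sits at `v` or `v.parent`, both beyond `w`, so nothing
before `w` can move. -/
theorem edgeChain_mem_of_parent_ne {v : StarVertex L} {T : Finset (StarVertex L)}
    (h : IsEdgeCell n v T) (hv : v.parent ≠ center) :
    edgeChain n v T ∈ Submodule.span ℤ (Set.range (basisChain L n)) ⊔
      LinearMap.range (confBoundary (subdividedStar L) n 1) := by
  induction hk : ∑ x ∈ T, x.height using Nat.strong_induction_on generalizing T with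
  | _ k ih =>
  subst hk
  set R : Finset (StarVertex L) := {w ∈ movable T | w < v} with hR
  rcases R.eq_empty_or_nonempty with hRe | hRn
  · refine Submodule.mem_sup_left (edgeChain_mem_of_forall_lt h hv fun w hw hlt hwc => ?_)
    by_contra hwT
    have : w ∈ R := Finset.mem_filter.2 ⟨mem_movable.2 ⟨hw, hwc, hwT⟩, hlt⟩
    rw [hRe] at this
    exact absurd this (Finset.notMem_empty _)
  · obtain ⟨w, hmem, hmin⟩ : ∃ w ∈ R, ∀ x ∈ R, w ≤ x :=
      ⟨R.min' hRn, R.min'_mem hRn, fun x hx => R.min'_le x hx⟩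
    obtain ⟨hmov, hlt⟩ := Finset.mem_filter.1 hmem
    obtain ⟨hw, hwc, hwT⟩ := mem_movable.1 hmov
    -- Strictness holds because `w` is occupied while `v.parent` is not; it makes the two edges
    -- disjoint.
    have hlt' : w < v.parent :=
      (le_parent_of_lt hv hlt).lt_of_ne fun h' => h.parent_notMem (h' ▸ hw)
    have hpw : w.parent < w := parent_lt (ne_center_of_parent hwc)
    have hpair := h.isPairCell hw hwc hwT (hpw.trans hlt).ne (hpw.trans hlt').ne
    have h1 := ih _ (sum_height_insert_parent_lt hw hwc hwT) hpair.insert_right_parent rfl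
    have h2 : ∀ u, w < u → IsEdgeCell n w (insert u (T.erase w)) →
        edgeChain n w (insert u (T.erase w)) ∈
          Submodule.span ℤ (Set.range (basisChain L n)) := by
      intro u hu hc
      refine edgeChain_mem_of_forall_lt hc hwc fun x hx hxw hxc => ?_
      have hxT : x ∈ T := Finset.mem_of_mem_erase
        ((Finset.mem_insert.1 hx).resolve_left (hxw.trans hu).ne)
      have hpx : x.parent ∈ T := by
        by_contra hpx
        exact absurd (hmin x (Finset.mem_filter.2
          ⟨mem_movable.2 ⟨hxT, hxc, hpx⟩, hxw.trans hlt⟩)) hxw.not_ge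
      exact Finset.mem_insert_of_mem (Finset.mem_erase.2
        ⟨((parent_lt (ne_center_of_parent hxc)).trans hxw).ne, hpx⟩)
    have h3 := edgeChain_mem_of_isPairCell hpair h1
      (Submodule.mem_sup_left (h2 _ hlt hpair.symm.insert_right))
      (Submodule.mem_sup_left (h2 _ hlt' hpair.symm.insert_right_parent))
    rwa [Finset.insert_erase hw, sup_assoc, sup_idem] at h3

/-- As long as `insert v T` is not packed, a square pushes some movable `w` inward. The correction
terms move `w` along a non-central edge and are already covered, so any movable `w` will do. -/
theorem edgeChain_mem_of_parent_eq {v : StarVertex L} {T : Finset (StarVertex L)}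
    (h : IsEdgeCell n v T) (hv : v.parent = center) :
    edgeChain n v T ∈ Submodule.span ℤ (Set.range (basisChain L n)) ⊔
      LinearMap.range (confBoundary (subdividedStar L) n 1) := by
  induction hk : ∑ x ∈ T, x.height using Nat.strong_induction_on generalizing T with
  | _ k ih =>
  subst hk
  by_cases hp : Packed (insert v T)
  · refine Submodule.mem_sup_left (Submodule.subset_span
      ⟨.inr ⟨(v, insert v T), ?_, hp, ?_, Finset.mem_insert_self _ _, hv⟩, ?_⟩)
    · rw [Finset.card_insert_of_notMem h.notMem, h.card_eq]
    · have := h.parent_notMem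
      rw [hv] at this
      simp [this, h.ne_center.symm]
    · simp only [basisChain, basisCell, Finset.erase_insert h.notMem]
  · obtain ⟨w, hw⟩ := movable_nonempty_iff.2 hp
    obtain ⟨hw1, hwc, hw2⟩ := mem_movable.1 hw
    have hwv : w ≠ v := by
      rintro rfl
      exact hwc hv
    have hwT : w ∈ T := (Finset.mem_insert.1 hw1).resolve_left hwv
    simp only [Finset.mem_insert, not_or] at hw2
    have hpair := h.isPairCell hwT hwc hw2.2 hw2.1 (by rwa [hv])
    have h3 := edgeChain_mem_of_isPairCell hpair
      (ih _ (sum_height_insert_parent_lt hwT hwc hw2.2) hpair.insert_right_parent rfl)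
      (edgeChain_mem_of_parent_ne hpair.symm.insert_right hwc)
      (edgeChain_mem_of_parent_ne hpair.symm.insert_right_parent hwc)
    rwa [Finset.insert_erase hwT, sup_assoc, sup_idem] at h3

theorem finrank_quotient_range_confBoundary_one :
    Module.finrank ℤ ((ConfCell (subdividedStar L) n 1 →₀ ℤ) ⧸
      LinearMap.range (confBoundary (subdividedStar L) n 1)) =
        Nat.card (Unpacked L n ⊕ PackedCentral L n) := by
  refine finrank_quotient_of_triangular _ (basisChain L n) (basisCoeff L n) (basisLevel L n)
    (fun b y hy => basisCoeff_eq_zero_of_mem_range b hy) basisCoeff_basisChain_self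
    (fun b b' => basisCoeff_basisChain_of_ne) (eq_top_of_edgeChain_mem fun v T h => ?_)
  by_cases hv : v.parent = center
  · exact edgeChain_mem_of_parent_eq h hv
  · exact edgeChain_mem_of_parent_ne h hv

/-- The packed configurations of `n` particles. -/
def PackedConf (L : Fin E → ℕ) (n : ℕ) : Set (Finset (StarVertex L)) :=
  {U | U.card = n ∧ Packed U}

/-- Unpacked configurations are counted once among the 0-cells and once in the basis of C₁ / im ∂₂,
so they drop out. -/
theorem finrank_confH1_add (hn : ∃ S : Finset (StarVertex L), S.card = n) :
    Module.finrank ℤ (ConfH1 (subdividedStar L) n) + (PackedConf L n).ncard =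
      (PackedCentral L n).ncard + 1 := by
  have h := finrank_homology_add_finrank (confBoundary (subdividedStar L) n 0)
    (confBoundary (subdividedStar L) n 1)
    fun x => LinearMap.congr_fun (confBoundary_comp (subdividedStar L) n 0) x
  rw [finrank_quotient_range_confBoundary_zero hn, finrank_quotient_range_confBoundary_one,
    Nat.card_sum, Module.finrank_eq_nat_card_basis Finsupp.basisSingleOne] at h
  have hX : Nat.card (ConfCell (subdividedStar L) n 0) =
      (PackedConf L n).ncard + (Unpacked L n).ncard := by
    have e : ConfCell (subdividedStar L) n 0 ≃ {S : Finset (StarVertex L) | S.card = n} :=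
      { toFun := fun c => ⟨c.verts, c.card_verts⟩
        invFun := fun S => vertCell S.1 S.2
        left_inv := fun c => (eq_vertCell c).symm
        right_inv := fun S => rfl }
    rw [Nat.card_congr e, Nat.card_coe_set_eq,
      ← Set.ncard_union_eq _ (Set.toFinite _) (Set.toFinite _)]
    · congr 1
      ext U
      simp only [PackedConf, Unpacked, Set.mem_ofPred_eq, Set.mem_union]
      tauto
    · rw [Set.disjoint_left]
      exact fun U h h' => h'.2 h.2
  rw [hX, Nat.card_coe_set_eq, Nat.card_coe_set_eq] at h
  have h' : Module.finrank ℤ (ConfH1 (subdividedStar L) n) + _ = _ := h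
  omega

end StarVertex

namespace StarVertex

variable {E : ℕ} {L : Fin E → ℕ} {n : ℕ}

/-! ### Counting packed configurations -/

/-- The ways to distribute `n` particles over the arms within their capacities. -/
def distributions (L : Fin E → ℕ) (n : ℕ) : Finset (Fin E → ℕ) :=
  {b ∈ Finset.piAntidiag Finset.univ n | ∀ i, b i ≤ L i}

theorem mem_distributions {b : Fin E → ℕ} :
    b ∈ distributions L n ↔ ∑ i, b i = n ∧ ∀ i, b i ≤ L i := by
  simp [distributions]

/-- The arm, as an embedding of its positions. -/
def armEmb (L : Fin E → ℕ) (i : Fin E) : Fin (L i) ↪ StarVertex L :=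
  ⟨arm i, fun j j' h => by simpa using h⟩

theorem armEmb_apply (i : Fin E) (j : Fin (L i)) : armEmb L i j = arm i j := rfl

theorem armIdx_arm (i : Fin E) (j : Fin (L i)) : (arm i j).armIdx = some i := rfl

/-- The packed configuration away from the centre with `b i` particles on the `i`-th arm. -/
def fill (L : Fin E → ℕ) (b : Fin E → ℕ) : Finset (StarVertex L) :=
  Finset.univ.biUnion fun i => ({j : Fin (L i) | (j : ℕ) < b i} : Finset _).map (armEmb L i)

theorem center_notMem_fill (b : Fin E → ℕ) : center ∉ fill L b := by
  simp [fill, armEmb_apply]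

theorem arm_mem_fill {b : Fin E → ℕ} {i : Fin E} {j : Fin (L i)} :
    arm i j ∈ fill L b ↔ (j : ℕ) < b i := by
  simp only [fill, armEmb_apply, Finset.mem_biUnion, Finset.mem_univ, true_and, Finset.mem_map,
    Finset.mem_filter]
  constructor
  · rintro ⟨i', j', h, h'⟩
    simp only [arm.injEq] at h'
    obtain ⟨rfl, h'⟩ := h'
    obtain rfl := eq_of_heq h'
    exact h
  · exact fun h => ⟨i, j, h, rfl⟩

theorem packed_fill (b : Fin E → ℕ) : Packed (fill L b) := by
  rintro (_ | ⟨i, ⟨_ | j, hj⟩⟩) hv hc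
  · exact absurd rfl hc
  · exact absurd rfl hc
  · rw [arm_mem_fill] at hv
    simp only [parent]
    rw [arm_mem_fill]
    simp only at hv ⊢
    omega

theorem counts_fill {b : Fin E → ℕ} (hb : ∀ i, b i ≤ L i) : counts (fill L b) = b := by
  ext i
  have : (fill L b).filter (fun v => v.armIdx = some i) =
      ({j : Fin (L i) | (j : ℕ) < b i} : Finset _).map (armEmb L i) := by
    ext v
    rcases v with _ | ⟨i', j⟩
    · simp [center_notMem_fill, armEmb_apply]
    · simp only [Finset.mem_filter, arm_mem_fill, Finset.mem_map, Finset.mem_univ, true_and,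
        armIdx_arm, Option.some.injEq, armEmb_apply]
      constructor
      · rintro ⟨h, rfl⟩
        exact ⟨j, h, rfl⟩
      · rintro ⟨j', h, h'⟩
        simp only [arm.injEq] at h'
        obtain ⟨rfl, h'⟩ := h'
        obtain rfl := eq_of_heq h'
        exact ⟨h, rfl⟩
  rw [counts, this, Finset.card_map, Fin.card_filter_val_lt, min_eq_right (hb i)]

theorem counts_le (U : Finset (StarVertex L)) (i : Fin E) : counts U i ≤ L i := by
  calc counts U i ≤ (Finset.univ.map (armEmb L i)).card := by
        refine Finset.card_le_card fun v hv => ?_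
        obtain ⟨-, h⟩ := Finset.mem_filter.1 hv
        rcases v with _ | ⟨i', j⟩
        · simp [armIdx] at h
        · obtain rfl : i' = i := by simpa [armIdx] using h
          exact Finset.mem_map_of_mem _ (Finset.mem_univ j)
    _ = L i := by simp

theorem sum_counts {U : Finset (StarVertex L)} (hU : center ∉ U) :
    ∑ i, counts U i = U.card := by
  rw [Finset.card_eq_sum_card_fiberwise (f := armIdx)
    (t := Finset.univ.map Function.Embedding.some), Finset.sum_map]
  · rfl
  · intro v hv
    rcases v with _ | ⟨i, j⟩
    · exact absurd hv hU
    · simp [armIdx]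

/-- The packed configurations of `n` particles away from the centre. -/
def PackedAway (L : Fin E → ℕ) (n : ℕ) : Set (Finset (StarVertex L)) :=
  {U | U.card = n ∧ Packed U ∧ center ∉ U}

theorem injOn_counts_packedAway : Set.InjOn counts (PackedAway L n) :=
  fun _ hU _ hU' h => hU.2.1.eq_of_counts_eq hU'.2.1 hU.2.2 hU'.2.2 h

theorem counts_mem_distributions {U : Finset (StarVertex L)} (hU : U ∈ PackedAway L n) :
    counts U ∈ distributions L n :=
  mem_distributions.2 ⟨(sum_counts hU.2.2).trans hU.1, counts_le U⟩

theorem fill_mem_packedAway {b : Fin E → ℕ} (hb : b ∈ distributions L n) :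
    fill L b ∈ PackedAway L n := by
  rw [mem_distributions] at hb
  refine ⟨?_, packed_fill b, center_notMem_fill b⟩
  rw [← sum_counts (center_notMem_fill b), counts_fill hb.2, hb.1]

theorem ncard_packedAway : (PackedAway L n).ncard = (distributions L n).card := by
  rw [← injOn_counts_packedAway.ncard_image, ← Set.ncard_coe_finset]
  congr 1
  ext b
  constructor
  · rintro ⟨U, hU, rfl⟩
    exact counts_mem_distributions hU
  · exact fun hb => ⟨fill L b, fill_mem_packedAway hb, counts_fill (mem_distributions.1 hb).2⟩

theorem packed_insert_center {U : Finset (StarVertex L)} :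
    Packed (insert center U) ↔ Packed U := by
  simp only [Packed, Finset.mem_insert]
  constructor
  · exact fun h v hv hc => (h v (Or.inr hv) hc).resolve_left hc
  · exact fun h v hv hc => Or.inr (h v (hv.resolve_left (ne_center_of_parent hc)) hc)

theorem ncard_packedConf_zero : (PackedConf L 0).ncard = 1 := by
  rw [Set.ncard_eq_one]
  refine ⟨∅, ?_⟩
  ext U
  simp only [PackedConf, Set.mem_ofPred_eq, Finset.card_eq_zero, Set.mem_singleton_iff,
    and_iff_left_iff_imp]
  rintro rfl
  simp [Packed]

/-- The two summands count the configurations with empty and with occupied centre; packedness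
ignores the centre. -/
theorem ncard_packedConf_succ :
    (PackedConf L (n + 1)).ncard =
      (distributions L (n + 1)).card + (distributions L n).card := by
  have h : PackedConf L (n + 1) = PackedAway L (n + 1) ∪ insert center '' PackedAway L n := by
    ext U
    constructor
    · rintro ⟨h1, h2⟩
      by_cases hc : center ∈ U
      · refine Or.inr ⟨U.erase center, ⟨?_, ?_, Finset.notMem_erase _ _⟩, Finset.insert_erase hc⟩
        · rw [Finset.card_erase_of_mem hc, h1, Nat.add_sub_cancel]
        · rwa [← packed_insert_center, Finset.insert_erase hc]
      · exact Or.inl ⟨h1, h2, hc⟩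
    · rintro (⟨h1, h2, -⟩ | ⟨U, ⟨h1, h2, h3⟩, rfl⟩)
      · exact ⟨h1, h2⟩
      · exact ⟨by rw [Finset.card_insert_of_notMem h3, h1], packed_insert_center.2 h2⟩
  rw [h, Set.ncard_union_eq _ (Set.toFinite _) (Set.toFinite _), Set.InjOn.ncard_image,
    ncard_packedAway, ncard_packedAway]
  · intro U hU U' hU' h
    have := congrArg (fun S => S.erase center) h
    simpa [Finset.erase_insert hU.2.2, Finset.erase_insert hU'.2.2] using this
  · rw [Set.disjoint_left]
    rintro _ hU ⟨U', -, rfl⟩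
    exact hU.2.2 (Finset.mem_insert_self _ _)

/-- In a packed configuration the neighbour of the centre on an arm is occupied exactly when the arm
is nonempty, so one counts pairs of a distribution and a nonempty arm. -/
theorem ncard_packedCentral (hL : ∀ i, 1 ≤ L i) :
    (PackedCentral L n).ncard =
      ∑ b ∈ distributions L n, ({i | 1 ≤ b i} : Finset (Fin E)).card := by
  let T : Finset ((Fin E → ℕ) × Fin E) := {q ∈ distributions L n ×ˢ Finset.univ | 1 ≤ q.1 q.2}
  have hT : T.card = ∑ b ∈ distributions L n, ({i | 1 ≤ b i} : Finset (Fin E)).card := by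
    simp only [T, Finset.card_filter, Finset.sum_product]
  have hmem : ∀ (b : Fin E → ℕ) (i : Fin E), b ∈ distributions L n → 1 ≤ b i →
      (arm i ⟨0, hL i⟩, fill L b) ∈ PackedCentral L n := by
    intro b i hb hi
    obtain ⟨h1, h2, h3⟩ := fill_mem_packedAway hb
    exact ⟨h1, h2, h3, arm_mem_fill.2 hi, rfl⟩
  rw [← hT, ← Set.ncard_coe_finset]
  symm
  refine Set.ncard_congr (fun q _ => (arm q.2 ⟨0, hL q.2⟩, fill L q.1)) ?_ ?_ ?_
  · rintro ⟨b, i⟩ hq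
    simp only [T, Finset.coe_filter, Finset.mem_product, Finset.mem_univ, and_true,
      Set.mem_ofPred_eq] at hq
    exact hmem b i hq.1 hq.2
  · rintro ⟨b, i⟩ ⟨b', i'⟩ hq hq' h
    simp only [T, Finset.coe_filter, Finset.mem_product, Finset.mem_univ, and_true,
      Set.mem_ofPred_eq] at hq hq'
    simp only [Prod.mk.injEq, arm.injEq] at h ⊢
    refine ⟨?_, h.1.1⟩
    rw [← counts_fill (mem_distributions.1 hq.1).2, h.2,
      counts_fill (mem_distributions.1 hq'.1).2]
  · rintro ⟨s, U⟩ ⟨h1, h2, h3, h4, h5⟩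
    simp only at h1 h2 h3 h4 h5
    have hU : U ∈ PackedAway L n := ⟨h1, h2, h3⟩
    have hb := counts_mem_distributions hU
    have hfill : fill L (counts U) = U :=
      injOn_counts_packedAway (fill_mem_packedAway hb) hU (counts_fill (mem_distributions.1 hb).2)
    rcases s with _ | ⟨i, ⟨_ | j, hj⟩⟩
    · exact absurd h4 h3
    · refine ⟨(counts U, i), ?_, ?_⟩
      · simp only [T, Finset.coe_filter, Finset.mem_product, Finset.mem_univ, and_true,
          Set.mem_ofPred_eq]
        rw [← hfill, arm_mem_fill] at h4
        exact ⟨hb, h4⟩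
      · simp only [hfill]
    · simp [parent] at h5

/-! ### Counting distributions -/

theorem card_piAntidiag_univ (E n : ℕ) :
    (Finset.piAntidiag (Finset.univ : Finset (Fin E)) n).card = (E + n - 1).choose n := by
  rw [← Finset.map_sym_eq_piAntidiag, Finset.card_map, Finset.sym_univ, Finset.card_univ,
    Sym.card_sym_eq_choose, Fintype.card_fin]

/-- Removing one particle from arm `i` is a bijection; `1 ≤ b i` makes the truncated subtraction
invertible. -/
theorem card_filter_piAntidiag_succ (i : Fin E) :
    ({b ∈ Finset.piAntidiag (Finset.univ : Finset (Fin E)) (n + 1) | 1 ≤ b i} : Finset _).card =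
      (Finset.piAntidiag (Finset.univ : Finset (Fin E)) n).card := by
  symm
  refine Finset.card_nbij' (fun b => b + Pi.single i 1) (fun b => b - Pi.single i 1) ?_ ?_ ?_ ?_
  · intro b hb
    simp only [Finset.coe_filter, Finset.mem_piAntidiag, Finset.mem_univ, implies_true, and_true,
      Finset.mem_coe] at hb ⊢
    simp [Finset.sum_add_distrib, hb]
  · intro b hb
    simp only [Finset.coe_filter, Finset.mem_piAntidiag, Finset.mem_univ, implies_true, and_true,
      Finset.mem_coe, Set.mem_ofPred_eq] at hb ⊢
    have h : b - Pi.single i 1 + Pi.single i 1 = b := by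
      ext j
      by_cases hj : j = i
      · subst hj; simp [hb.2]
      · simp [hj]
    have h' := hb.1
    rw [← h] at h'
    simpa [Finset.sum_add_distrib] using h'
  · intro b _
    simp
  · intro b hb
    simp only [Finset.coe_filter, Set.mem_ofPred_eq] at hb
    ext j
    by_cases hj : j = i
    · subst hj; simp [hb.2]
    · simp [hj]

theorem distributions_eq_piAntidiag (hL : ∀ i, n ≤ L i) :
    distributions L n = Finset.piAntidiag Finset.univ n := by
  refine Finset.filter_true_of_mem fun b hb i => ?_
  rw [Finset.mem_piAntidiag] at hb
  exact ((Finset.single_le_sum (fun _ _ => Nat.zero_le _) (Finset.mem_univ i)).trans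
    hb.1.le).trans (hL i)

theorem card_support_of_lt {b : Fin E → ℕ} {i : Fin E} (hb : ∑ i, b i = n + 1) (hi : n < b i) :
    ({i | 1 ≤ b i} : Finset (Fin E)).card = 1 := by
  rw [Finset.card_eq_one]
  refine ⟨i, ?_⟩
  ext j
  simp only [Finset.mem_filter, Finset.mem_univ, true_and, Finset.mem_singleton]
  constructor
  · intro hj
    by_contra hne
    have h := Finset.sum_le_sum_of_subset (f := b) (Finset.subset_univ {j, i})
    rw [Finset.sum_pair hne, hb] at h
    omega
  · rintro rfl
    omega

/-- Without capacities the sum is `E * (E + n - 1).choose n`, by counting pairs arm by arm. A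
distribution of `n + 1` particles violating a capacity has all of them on one arm, so it contributes
1 both to the sum and to the number of distributions, and the two corrections agree. -/
theorem sum_card_support_add (hL : ∀ i, n ≤ L i) :
    ∑ b ∈ distributions L (n + 1), ({i | 1 ≤ b i} : Finset (Fin E)).card + (E + n).choose (n + 1) =
      E * (E + n - 1).choose n + (distributions L (n + 1)).card := by
  have h1 : ∑ b ∈ Finset.piAntidiag Finset.univ (n + 1), ({i | 1 ≤ b i} : Finset (Fin E)).card =
      E * (E + n - 1).choose n := by
    simp only [Finset.card_filter]
    rw [Finset.sum_comm]
    simp only [← Finset.card_filter, card_filter_piAntidiag_succ, card_piAntidiag_univ]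
    simp
  have h2 := Finset.sum_filter_add_sum_filter_not (Finset.piAntidiag Finset.univ (n + 1))
    (fun b => ∀ i, b i ≤ L i) fun b => ({i | 1 ≤ b i} : Finset (Fin E)).card
  have h3 := Finset.card_filter_add_card_filter_not (s := Finset.piAntidiag Finset.univ (n + 1))
    (fun b => ∀ i, b i ≤ L i)
  have h4 : ∑ b ∈ Finset.piAntidiag Finset.univ (n + 1) with ¬ ∀ i, b i ≤ L i,
      ({i | 1 ≤ b i} : Finset (Fin E)).card =
      ({b ∈ Finset.piAntidiag Finset.univ (n + 1) | ¬ ∀ i, b i ≤ L i} : Finset _).card := by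
    rw [Finset.card_eq_sum_ones]
    refine Finset.sum_congr rfl fun b hb => ?_
    obtain ⟨hb1, hb2⟩ := Finset.mem_filter.1 hb
    push Not at hb2
    obtain ⟨i, hi⟩ := hb2
    exact card_support_of_lt (Finset.mem_piAntidiag.1 hb1).1 ((hL i).trans_lt hi)
  rw [card_piAntidiag_univ, show E + (n + 1) - 1 = E + n by omega] at h3
  simp only [distributions]
  omega

/-- With two arms the first entry determines the distribution, and the capacities confine it to an
interval. -/
theorem card_filter_distributions_two (L : Fin 2 → ℕ) (n : ℕ) (p : (Fin 2 → ℕ) → Prop)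
    [DecidablePred p] :
    ({b ∈ distributions L n | p b} : Finset _).card =
      ({x ∈ Finset.Icc (n - L 1) (min (L 0) n) | p ![x, n - x]} : Finset ℕ).card := by
  have key : ∀ b ∈ distributions L n, ![b 0, n - b 0] = b := by
    intro b hb
    have h := (mem_distributions.1 hb).1
    rw [Fin.sum_univ_two] at h
    ext i
    fin_cases i
    · rfl
    · simp; omega
  refine Finset.card_nbij' (fun b => b 0) (fun x => ![x, n - x]) ?_ ?_ ?_ ?_
  · intro b hb
    obtain ⟨h1, h2⟩ := Finset.mem_filter.1 hb
    refine Finset.mem_filter.2 ⟨?_, by rwa [key b h1]⟩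
    obtain ⟨h3, h4⟩ := mem_distributions.1 h1
    rw [Fin.sum_univ_two] at h3
    have := h4 0
    have := h4 1
    simp only [Finset.mem_Icc]
    omega
  · intro x hx
    obtain ⟨h1, h2⟩ := Finset.mem_filter.1 hx
    refine Finset.mem_filter.2 ⟨mem_distributions.2 ⟨?_, ?_⟩, h2⟩
    · rw [Finset.mem_Icc] at h1
      simp; omega
    · rw [Finset.mem_Icc] at h1
      rw [Fin.forall_fin_two]
      simp; omega
  · intro b hb
    exact key b (Finset.mem_filter.1 hb).1
  · intro x _
    rfl

/-- This is the Euler characteristic of a path: one edge fewer than vertices, so H₁ has rank zero.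
The arms may be shorter than `n`, hence the explicit intervals; `hn` keeps those for `n` particles
nonempty. -/
theorem sum_card_support_two (L : Fin 2 → ℕ) (hn : n ≤ L 0 + L 1) :
    ∑ b ∈ distributions L (n + 1), ({i | 1 ≤ b i} : Finset (Fin 2)).card + 1 =
      (distributions L (n + 1)).card + (distributions L n).card := by
  have h0 := card_filter_distributions_two L (n + 1) fun b => 1 ≤ b 0
  have h1 := card_filter_distributions_two L (n + 1) fun b => 1 ≤ b 1
  have h2 := card_filter_distributions_two L (n + 1) fun _ => True
  have h3 := card_filter_distributions_two L n fun _ => True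
  have e0 : ({x ∈ Finset.Icc (n + 1 - L 1) (min (L 0) (n + 1)) |
      1 ≤ ![x, n + 1 - x] 0} : Finset ℕ) = Finset.Icc (max 1 (n + 1 - L 1)) (min (L 0) (n + 1)) := by
    ext x
    rw [Finset.mem_filter]
    simp only [Finset.mem_Icc, Matrix.cons_val_zero]
    omega
  have e1 : ({x ∈ Finset.Icc (n + 1 - L 1) (min (L 0) (n + 1)) |
      1 ≤ ![x, n + 1 - x] 1} : Finset ℕ) = Finset.Icc (n + 1 - L 1) (min (L 0) n) := by
    ext x
    rw [Finset.mem_filter]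
    simp only [Finset.mem_Icc, Matrix.cons_val_zero, Matrix.cons_val_one]
    omega
  rw [e0, Nat.card_Icc] at h0
  rw [e1, Nat.card_Icc] at h1
  rw [Finset.filter_true, Finset.filter_true, Nat.card_Icc] at h2 h3
  have h4 : ∑ b ∈ distributions L (n + 1), ({i | 1 ≤ b i} : Finset (Fin 2)).card =
      ({b ∈ distributions L (n + 1) | 1 ≤ b 0} : Finset _).card +
        ({b ∈ distributions L (n + 1) | 1 ≤ b 1} : Finset _).card := by
    simp only [Finset.card_filter, Fin.sum_univ_two, Finset.sum_add_distrib]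
  omega

end StarVertex

/-! ### Assembling the rank formula. -/

-- Two full arms and the centre already hold `L i + L j + 1` particles, so the complex has a 0-cell.
open StarVertex in
theorem exists_card_eq_of_le {E : ℕ} {L : Fin E → ℕ} {n : ℕ} {i j : Fin E} (hij : i ≠ j)
    (h : n ≤ L i + L j + 1) : ∃ S : Finset (StarVertex L), S.card = n := by
  have h1 : L i + L j ≤ ∑ k, L k := by
    rw [← Finset.sum_pair hij]
    exact Finset.sum_le_sum_of_subset (Finset.subset_univ _)
  have h2 : (insert center (fill L L)).card = ∑ k, L k + 1 := by
    rw [Finset.card_insert_of_notMem (center_notMem_fill _),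
      ← sum_counts (center_notMem_fill _), counts_fill fun _ => le_rfl]
  obtain ⟨S, -, hS⟩ := Finset.exists_subset_card_eq
    (show n ≤ (insert center (fill L L)).card by omega)
  exact ⟨S, hS⟩

theorem finrank_confH1_succ {E : ℕ} (hE : 2 ≤ E) (n : ℕ) (L : Fin E → ℕ) (hL : ∀ i, 1 ≤ L i)
    (h : SufficientlySubdivided (subdividedStar L) (n + 1)) :
    Module.finrank ℤ (ConfH1 (subdividedStar L) (n + 1)) + (E + n).choose (n + 1) +
      (E + n - 1).choose n = E * (E + n - 1).choose n + 1 := by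
  have hij : (⟨0, by omega⟩ : Fin E) ≠ ⟨1, by omega⟩ := by simp
  have hlen := h.le_length_add_length hL hij
  have hrank := StarVertex.finrank_confH1_add (exists_card_eq_of_le hij hlen)
  rw [StarVertex.ncard_packedConf_succ, StarVertex.ncard_packedCentral hL] at hrank
  rcases hE.eq_or_lt with rfl | hE
  · have h1 := StarVertex.sum_card_support_two L (n := n) (by simpa using hlen)
    have h2 : (2 + n).choose (n + 1) = n + 2 := by
      rw [show 2 + n = n + 1 + 1 by omega, Nat.choose_succ_self_right]
    have h3 : (2 + n - 1).choose n = n + 1 := by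
      rw [show 2 + n - 1 = n + 1 by omega, Nat.choose_succ_self_right]
    rw [h2, h3]
    omega
  · have hn : ∀ i, n ≤ L i := fun i => by
      have := h.le_length_add_one hE hL i
      omega
    have h1 := StarVertex.sum_card_support_add hn
    rw [StarVertex.distributions_eq_piAntidiag hn, StarVertex.card_piAntidiag_univ] at hrank
    omega

theorem finrank_confH1_zero {E : ℕ} (L : Fin E → ℕ) (hL : ∀ i, 1 ≤ L i) :
    Module.finrank ℤ (ConfH1 (subdividedStar L) 0) = 0 := by
  have hrank := StarVertex.finrank_confH1_add (L := L) ⟨∅, Finset.card_empty⟩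
  have h : StarVertex.distributions L 0 = {0} := by
    rw [StarVertex.distributions_eq_piAntidiag fun i => Nat.zero_le _, Finset.piAntidiag_zero]
  rw [StarVertex.ncard_packedConf_zero, StarVertex.ncard_packedCentral hL, h] at hrank
  simpa using hrank

theorem finrank_confH1 {E : ℕ} (hE : 2 ≤ E) (n : ℕ) (L : Fin E → ℕ) (hL : ∀ i, 1 ≤ L i)
    (h : SufficientlySubdivided (subdividedStar L) n) :
    (Module.finrank ℤ (ConfH1 (subdividedStar L) n) : ℤ) =
      ((n + E - 2).choose (E - 1) : ℤ) * ((E : ℤ) - 2) - ((n + E - 2).choose (E - 2) : ℤ) + 1 := by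
  obtain ⟨k, rfl⟩ : ∃ k, E = k + 2 := ⟨E - 2, by omega⟩
  rcases n with _ | n
  · rw [finrank_confH1_zero L hL]
    simp
  · have h1 := finrank_confH1_succ hE n L hL h
    have e1 : (k + 2 + n).choose (n + 1) = (n + k + 1).choose k + (n + k + 1).choose (k + 1) := by
      rw [← Nat.choose_succ_succ, ← Nat.choose_symm_of_eq_add (a := k + 1)]
      · congr 1; omega
      · omega
    have e2 : (k + 2 + n - 1).choose n = (n + k + 1).choose (k + 1) := by
      rw [show k + 2 + n - 1 = n + k + 1 by omega]
      exact Nat.choose_symm_of_eq_add (by omega)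
    rw [e1, e2] at h1
    rw [show n + 1 + (k + 2) - 2 = n + k + 1 by omega, show k + 2 - 1 = k + 1 by omega,
      show k + 2 - 2 = k by omega]
    have h2 : (Module.finrank ℤ (ConfH1 (subdividedStar L) (n + 1)) : ℤ) +
        ((n + k + 1).choose k + (n + k + 1).choose (k + 1)) + (n + k + 1).choose (k + 1) =
        (k + 2) * (n + k + 1).choose (k + 1) + 1 := by exact_mod_cast h1
    push_cast
    linarith

/-! ### Monotonicity in the number of particles. -/

/-- The rank formula with `k + 3` arms is strictly increasing in the number of particles. -/
theorem starRank_lt_succ (k n : ℕ) (hn : 1 ≤ n) :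
    ((n + k + 1).choose (k + 2) : ℤ) * (k + 1) - (n + k + 1).choose (k + 1) <
      ((n + 1 + k + 1).choose (k + 2) : ℤ) * (k + 1) - (n + 1 + k + 1).choose (k + 1) := by
  have h1 : (n + 1 + k + 1).choose (k + 2) =
      (n + k + 1).choose (k + 1) + (n + k + 1).choose (k + 2) := by
    rw [show n + 1 + k + 1 = n + k + 1 + 1 by omega, Nat.choose_succ_succ]
  have h2 : (n + 1 + k + 1).choose (k + 1) =
      (n + k + 1).choose k + (n + k + 1).choose (k + 1) := by
    rw [show n + 1 + k + 1 = n + k + 1 + 1 by omega, Nat.choose_succ_succ]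
  have h3 := Nat.choose_succ_right_eq (n + k + 1) k
  rw [show n + k + 1 - k = n + 1 by omega] at h3
  have h4 : 0 < (n + k + 1).choose k := Nat.choose_pos (by omega)
  -- By Pascal's rule the increment of the rank is the difference of these two sides. The right side
  -- equals `(n + 1)` times the left, so it is strictly larger exactly because `n ≥ 1`.
  have h5 : (n + k + 1).choose k < (n + k + 1).choose (k + 1) * (k + 1) := by
    rw [h3]
    nlinarith
  rw [h1, h2]
  have h6 : ((n + k + 1).choose k : ℤ) < (n + k + 1).choose (k + 1) * (k + 1) := by
    exact_mod_cast h5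
  push_cast
  linarith

theorem starRank_lt (k n m : ℕ) (hn : 1 ≤ n) (hnm : n < m) :
    ((n + k + 1).choose (k + 2) : ℤ) * (k + 1) - (n + k + 1).choose (k + 1) <
      ((m + k + 1).choose (k + 2) : ℤ) * (k + 1) - (m + k + 1).choose (k + 1) := by
  induction m, hnm using Nat.le_induction with
  | base => exact starRank_lt_succ k n hn
  | succ m hm ih => exact ih.trans (starRank_lt_succ k m (by omega))

theorem mainTheorem5 (E : ℕ) (hE : 2 ≤ E) :
    (∀ (n : ℕ) (L : Fin E → ℕ), (∀ i, 1 ≤ L i) → SufficientlySubdivided (subdividedStar L) n →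
      Module.Finite ℤ (ConfH1 (subdividedStar L) n) ∧
      (Module.finrank ℤ (ConfH1 (subdividedStar L) n) : ℤ) =
        ((n + E - 2).choose (E - 1) : ℤ) * ((E : ℤ) - 2) - ((n + E - 2).choose (E - 2) : ℤ) + 1) ∧
    (3 ≤ E → ∀ (n m : ℕ) (L L' : Fin E → ℕ), (∀ i, 1 ≤ L i) → (∀ i, 1 ≤ L' i) →
      SufficientlySubdivided (subdividedStar L) n → SufficientlySubdivided (subdividedStar L') m →
      1 ≤ n → n < m →
      Module.finrank ℤ (ConfH1 (subdividedStar L) n) <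
        Module.finrank ℤ (ConfH1 (subdividedStar L') m)) := by
  refine ⟨fun n L hL h => ⟨inferInstance, finrank_confH1 hE n L hL h⟩, ?_⟩
  intro hE3 n m L L' hL hL' h h' hn hnm
  obtain ⟨k, rfl⟩ : ∃ k, E = k + 3 := ⟨E - 3, by omega⟩
  have e1 := finrank_confH1 hE n L hL h
  have e2 := finrank_confH1 hE m L' hL' h'
  have hlt := starRank_lt k n m hn hnm
  simp only [show ∀ a, a + (k + 3) - 2 = a + k + 1 by omega, show k + 3 - 1 = k + 2 by omega,
    show k + 3 - 2 = k + 1 by omega] at e1 e2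
  have e3 : ((k + 3 : ℕ) : ℤ) - 2 = k + 1 := by push_cast; ring
  rw [e3] at e1 e2
  have : (Module.finrank ℤ (ConfH1 (subdividedStar L) n) : ℤ) <
      Module.finrank ℤ (ConfH1 (subdividedStar L') m) := by rw [e1, e2]; linarith
  exact_mod_cast this
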